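/- Let $G=\mathrm{SL}(2,\mathbb R)$ with a Haar measure, and let $K=\mathrm{SO}(2)=\{k_\theta\}$ with $k_\theta=\begin{pmatrix}\cos\theta&\sin\theta\\-\sin\theta&\cos\theta\end{pmatrix}$, $e_m(k_\theta)=e^{im\theta}$. Write $x=K(x)\,a_{H(x)}\,n$ for the Iwasawa decomposition of $x \in G$, where $a_t=\mathrm{diag}(e^t,e^{-t})$ and $n$ is upper triangular unipotent. For $\lambda\in\mathbb C$ the principal series acts on functions on $K$ by $$(\pi_\lambda(x)f)(k)=e^{(i\lambda-1)H(x^{-1}k^{-1})}f\big(K(x^{-1}k^{-1})^{-1}\big).$$ For a nonzero integer $k$ let $\mathbb Z(k)$ be the set of integers $m$ of parity opposite to that of $k$ with $m\ge k+1$ if $k\ge1$, and $m\le k-1$ if $k\le-1$. The closed span of $\{e_m: m\in\mathbb Z(k)\}$ is stable under $\pi_{i|k|}$; let $\langle\cdot,\cdot\rangle_k$ be the inner product (unique up to a positive factor) for which this subrepresentation is unitary. The $e_m$ are orthogonal for it, with $\langle e_m,e_m\rangle_k=\frac{j!\,|k|!}{(j+|k|)!}$ for $|m|=|k|+1+2j$,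 up to that factor. The resulting unitary representation $\pi_{ik}$ on the completion $H_k$ is the discrete series representation with parameter $k$. Put $e_n^k=e_n/\|e_n\|_k$ and $\psi^{n,n}_{ik}(x)=\langle\pi_{ik}(x)e_n^k,e_n^k\rangle_k$ for $n\in\mathbb Z(k)$. For $0<p<\infty$ and $0<q\le\infty$, $L^{p,q}(G)$ is the space of measurable $f$ with $\|f\|_{p,q}<\infty$, where, with $d_f(\alpha)=\mathrm{meas}\{x\in G:|f(x)|>\alpha\}$, $$\|f\|_{p,q}=p^{1/q}\Big(\int_0^\infty\alpha^q d_f(\alpha)^{q/p}\frac{d\alpha}{\alpha}\Big)^{1/q}\ (q<\infty),\qquad \|f\|_{p,\infty}=\sup_{\alpha>0}\alpha^p d_f(\alpha).$$ **Lemma.** Let $0<p\le2$, $\gamma_p=\frac2p-1$, let $k$ be a nonzero integer and $n\in\mathbb Z(k)$. Then $\psi^{n,n}_{ik}\in L^{p,\infty}(G)$ if and only if $|k|\ge\gamma_p$. Moreover, if $|k|=\gamma_p$, then for every $0<q\le\infty$ one has $\psi^{n,n}_{ik}\in L^{p,q}(G)$ if and only if $q=\infty$. -/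

import Mathlib

open MeasureTheory
open scoped ENNReal

noncomputable section

/-! ### Lorentz spaces -/

/-- The distribution function `d_f(α) = μ {x | α < |f x|}`. -/
def distribFun {X : Type*} [MeasurableSpace X] (μ : Measure X) (f : X → ℂ) (α : ℝ) : ℝ≥0∞ :=
  μ {x | α < ‖f x‖}

/-- The Lorentz functional `‖f‖_{p,q}`, for `0 < p < ∞` and `0 < q ≤ ∞`, with values in `[0, ∞]`:
`p^{1/q} (∫_0^∞ α^q d_f(α)^{q/p} dα/α)^{1/q}` for `q < ∞`, and `sup_{α > 0} α^p d_f(α)` for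
`q = ∞`. -/
def lorentzNorm {X : Type*} [MeasurableSpace X] (μ : Measure X) (f : X → ℂ) (p : ℝ) (q : ℝ≥0∞) :
    ℝ≥0∞ :=
  if q = ∞ then ⨆ (α : ℝ) (_ : 0 < α), ENNReal.ofReal (α ^ p) * distribFun μ f α
  else ENNReal.ofReal (p ^ (1 / q.toReal)) *
    (∫⁻ α in Set.Ioi (0 : ℝ),
      ENNReal.ofReal (α ^ q.toReal) * distribFun μ f α ^ (q.toReal / p) * ENNReal.ofReal (1 / α))
        ^ (1 / q.toReal)

/-- `f` belongs to the Lorentz space `L^{p,q}(X, μ)`. -/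
def MemLorentz {X : Type*} [MeasurableSpace X] (μ : Measure X) (f : X → ℂ) (p : ℝ) (q : ℝ≥0∞) :
    Prop :=
  AEStronglyMeasurable f μ ∧ lorentzNorm μ f p q < ∞

/-! ### The group `G = SL(2, ℝ)` and the Iwasawa decomposition -/

/-- The group `G = SL(2, ℝ)`, with the topology of Mathlib. -/
abbrev SL2R : Type := Matrix.SpecialLinearGroup (Fin 2) ℝ

instance instMeasurableSpaceSL2R : MeasurableSpace SL2R := borel SL2R

instance instBorelSpaceSL2R : BorelSpace SL2R := ⟨rfl⟩

namespace SL2R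

/-- The element `k_θ = (cos θ, sin θ; -sin θ, cos θ)` of `K = SO(2)`, as a function of
`z = e^{iθ}`. We identify `K` with the circle group by means of this map. -/
def rot (z : Circle) : SL2R :=
  ⟨!![(z : ℂ).re, (z : ℂ).im; -(z : ℂ).im, (z : ℂ).re], by
    have h := Circle.normSq_coe z
    rw [Complex.normSq_apply] at h
    rw [Matrix.det_fin_two_of]
    linarith⟩

lemma col_pos (x : SL2R) : 0 < x 0 0 ^ 2 + x 1 0 ^ 2 := by
  have h := x.det_coe
  rw [Matrix.det_fin_two] at h
  by_contra hn
  have h0 : x 0 0 = 0 := by nlinarith [sq_nonneg (x 0 0), sq_nonneg (x 1 0)]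
  have h1 : x 1 0 = 0 := by nlinarith [sq_nonneg (x 0 0), sq_nonneg (x 1 0)]
  rw [h0, h1] at h
  simp at h

/-- The `A`-part `t = H(x)` of `x = k_θ a_t n_v`: `e^{2t} = a² + c²`, where `(a, c)` is the first
column of `x`. -/
def iwasawaH (x : SL2R) : ℝ := Real.log (x 0 0 ^ 2 + x 1 0 ^ 2) / 2

/-- The `K`-part `k_θ = K(x)` of `x = k_θ a_t n_v`: `e^{iθ} = (a - i c) / √(a² + c²)`. -/
def iwasawaK (x : SL2R) : Circle :=
  ⟨((x 0 0 : ℂ) - Complex.I * (x 1 0 : ℂ)) / (√(x 0 0 ^ 2 + x 1 0 ^ 2) : ℝ), by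
    have h := col_pos x
    have h2 : ‖(x 0 0 : ℂ) - Complex.I * (x 1 0 : ℂ)‖ = √(x 0 0 ^ 2 + x 1 0 ^ 2) := by
      rw [Complex.norm_def, Complex.normSq_apply]
      simp [pow_two]
    refine mem_sphere_zero_iff_norm.2 ?_
    rw [norm_div, h2, Complex.norm_real, Real.norm_of_nonneg (Real.sqrt_nonneg _)]
    exact div_self (Real.sqrt_pos.2 h).ne'⟩

lemma coe_iwasawaK (x : SL2R) : (iwasawaK x : ℂ) =
    ((x 0 0 : ℂ) - Complex.I * (x 1 0 : ℂ)) / (√(x 0 0 ^ 2 + x 1 0 ^ 2) : ℝ) := rfl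

lemma exp_iwasawaH (x : SL2R) : Real.exp (iwasawaH x) = √(x 0 0 ^ 2 + x 1 0 ^ 2) := by
  rw [iwasawaH, Real.sqrt_eq_rpow, Real.rpow_def_of_pos (col_pos x)]
  ring_nf

/-- The Iwasawa decomposition, in the form `K(x)⁻¹ x ∈ A N`. -/
lemma iwasawa (x : SL2R) : ∃ v : ℝ, (x : Matrix (Fin 2) (Fin 2) ℝ) =
    rot (iwasawaK x) * !![Real.exp (iwasawaH x), 0; 0, Real.exp (-iwasawaH x)] * !![1, v; 0, 1] := by
  have h := col_pos x
  have hd := x.det_coe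
  rw [Matrix.det_fin_two] at hd
  set r := √(x 0 0 ^ 2 + x 1 0 ^ 2) with hr
  have hr0 : r ≠ 0 := (Real.sqrt_pos.2 h).ne'
  have hr2 : r ^ 2 = x 0 0 ^ 2 + x 1 0 ^ 2 := Real.sq_sqrt h.le
  have hre : (iwasawaK x : ℂ).re = x 0 0 / r := by
    rw [coe_iwasawaK, Complex.div_ofReal_re]; simp [hr]
  have him : (iwasawaK x : ℂ).im = -(x 1 0) / r := by
    rw [coe_iwasawaK, Complex.div_ofReal_im]; simp [hr]
  refine ⟨(x 0 0 * x 0 1 + x 1 0 * x 1 1) / r ^ 2, ?_⟩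
  rw [Real.exp_neg, exp_iwasawaH, ← hr]
  ext i j
  fin_cases i <;> fin_cases j <;>
    simp [rot, hre, him, Matrix.mul_apply, Fin.sum_univ_two] <;> field_simp
  · rw [hr2]; linear_combination (-(x 1 0)) * hd
  · rw [hr2]; linear_combination (x 0 0) * hd

lemma rot_re_im (x : SL2R) :
    (iwasawaK x : ℂ).re = x 0 0 / √(x 0 0 ^ 2 + x 1 0 ^ 2) ∧
    (iwasawaK x : ℂ).im = -(x 1 0) / √(x 0 0 ^ 2 + x 1 0 ^ 2) := by
  rw [coe_iwasawaK, Complex.div_ofReal_re, Complex.div_ofReal_im]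
  simp

lemma mul_entry (y x : SL2R) (i : Fin 2) :
    (y * x) i 0 = y i 0 * x 0 0 + y i 1 * x 1 0 := by
  rw [Matrix.SpecialLinearGroup.coe_mul, Matrix.mul_apply, Fin.sum_univ_two]

/-- The first column of `y x` is `e^{H(x)}` times the first column of `y K(x)`. -/
lemma mul_col (y x : SL2R) (i : Fin 2) :
    (y * x) i 0 = Real.exp (iwasawaH x) * (y * rot (iwasawaK x)) i 0 := by
  have hr0 : √(x 0 0 ^ 2 + x 1 0 ^ 2) ≠ 0 := (Real.sqrt_pos.2 (col_pos x)).ne'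
  obtain ⟨h1, h2⟩ := rot_re_im x
  have e0 : rot (iwasawaK x) 0 0 = x 0 0 / √(x 0 0 ^ 2 + x 1 0 ^ 2) := h1
  have e1 : rot (iwasawaK x) 1 0 = x 1 0 / √(x 0 0 ^ 2 + x 1 0 ^ 2) := by
    have : rot (iwasawaK x) 1 0 = -(iwasawaK x : ℂ).im := rfl
    rw [this, h2, neg_div, neg_neg]
  rw [exp_iwasawaH, mul_entry, mul_entry, e0, e1]
  field_simp

/-- The cocycle identity for `H`. -/
lemma iwasawaH_mul (y x : SL2R) :
    iwasawaH (y * x) = iwasawaH x + iwasawaH (y * rot (iwasawaK x)) := by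
  have h := col_pos (y * rot (iwasawaK x))
  have he := Real.exp_pos (iwasawaH x)
  have h1 : iwasawaH (y * rot (iwasawaK x)) =
    Real.log ((y * rot (iwasawaK x)) 0 0 ^ 2 + (y * rot (iwasawaK x)) 1 0 ^ 2) / 2 := rfl
  have h2 : iwasawaH (y * x) = Real.log ((y * x) 0 0 ^ 2 + (y * x) 1 0 ^ 2) / 2 := rfl
  rw [h1, h2, mul_col y x, mul_col y x, mul_pow, mul_pow, ← mul_add,
    Real.log_mul (by positivity) h.ne', Real.log_pow, Real.log_exp]
  push_cast
  ring

lemma iwasawaK_mul (y x : SL2R) : iwasawaK (y * x) = iwasawaK (y * rot (iwasawaK x)) := by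
  have h := col_pos (y * rot (iwasawaK x))
  have he := Real.exp_pos (iwasawaH x)
  apply Circle.ext
  rw [coe_iwasawaK, coe_iwasawaK, mul_col y x, mul_col y x, mul_pow, mul_pow, ← mul_add,
    Real.sqrt_mul (by positivity), Real.sqrt_sq he.le]
  push_cast
  have h3 : (√((y * rot (iwasawaK x)) 0 0 ^ 2 + (y * rot (iwasawaK x)) 1 0 ^ 2) : ℂ) ≠ 0 :=
    Complex.ofReal_ne_zero.2 (Real.sqrt_pos.2 h).ne'
  have h4 : Complex.exp (iwasawaH x : ℂ) ≠ 0 := Complex.exp_ne_zero _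
  field_simp

lemma rot_inv (z : Circle) : (rot z)⁻¹ = rot z⁻¹ := by
  ext i j
  have h : ((z⁻¹ : Circle) : ℂ) = (starRingEnd ℂ) (z : ℂ) := Circle.coe_inv_eq_conj z
  have h1 : ((z⁻¹ : Circle) : ℂ).re = (z : ℂ).re := by rw [h, Complex.conj_re]
  have h2 : ((z⁻¹ : Circle) : ℂ).im = -(z : ℂ).im := by rw [h, Complex.conj_im]
  have h3 : (rot z)⁻¹ i j =
      Matrix.adjugate !![(z : ℂ).re, (z : ℂ).im; -(z : ℂ).im, (z : ℂ).re] i j :=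
    congrFun (congrFun (Matrix.SpecialLinearGroup.coe_inv (rot z)) i) j
  rw [h3, Matrix.adjugate_fin_two_of]
  simp only [rot, h1, h2]

lemma iwasawaK_rot (z : Circle) : iwasawaK (rot z) = z := by
  have h := Circle.normSq_coe z
  rw [Complex.normSq_apply] at h
  have h2 : (z : ℂ).re ^ 2 + (z : ℂ).im ^ 2 = 1 := by linarith
  apply Circle.ext
  rw [coe_iwasawaK]
  apply Complex.ext <;> simp [rot, h2]

lemma iwasawaH_rot (z : Circle) : iwasawaH (rot z) = 0 := by
  have h := Circle.normSq_coe z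
  rw [Complex.normSq_apply] at h
  have h2 : (z : ℂ).re ^ 2 + (z : ℂ).im ^ 2 = 1 := by linarith
  simp [iwasawaH, rot, h2]

lemma continuous_rot : Continuous rot := by
  refine Continuous.subtype_mk ?_ _
  refine continuous_matrix fun i j => ?_
  fin_cases i <;> fin_cases j <;> simp <;> fun_prop

lemma continuous_iwasawaH : Continuous iwasawaH := by
  unfold iwasawaH
  refine Continuous.div_const (Continuous.log ?_ fun x => (col_pos x).ne') _
  fun_prop

lemma continuous_iwasawaK : Continuous iwasawaK := by
  refine Continuous.subtype_mk ?_ _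
  refine Continuous.div ?_ ?_ fun x => Complex.ofReal_ne_zero.2 (Real.sqrt_pos.2 (col_pos x)).ne'
  · fun_prop
  · fun_prop

/-! ### The principal series -/

/-- The operator `π_λ(x)` of the principal series, on continuous functions on `K`:
`(π_λ(x) f)(k) = e^{(iλ - 1) H(x⁻¹ k⁻¹)} f(K(x⁻¹ k⁻¹)⁻¹)`. -/
def principalSeriesOp (lam : ℂ) (x : SL2R) (f : C(Circle, ℂ)) : C(Circle, ℂ) where
  toFun z := Complex.exp ((Complex.I * lam - 1) * (iwasawaH (x⁻¹ * (rot z)⁻¹) : ℂ)) *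
    f (iwasawaK (x⁻¹ * (rot z)⁻¹))⁻¹
  continuous_toFun := by
    have h := continuous_iwasawaH
    have h1 := continuous_iwasawaK
    have h2 := continuous_rot
    fun_prop

/-- The principal series representation `π_λ` of `G` on continuous functions on `K`. Its restriction
to the closed span of the characters `e_n` with `n` even (odd) is `π_{τ₊,λ}` (`π_{τ₋,λ}`). -/
def principalSeries (lam : ℂ) : Representation ℂ SL2R C(Circle, ℂ) where
  toFun x :=
    { toFun := principalSeriesOp lam x
      map_add' := fun f g => by ext z; simp [principalSeriesOp, mul_add]
      map_smul' := fun c f => by ext z; simp [principalSeriesOp, mul_left_comm] }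
  map_one' := by
    ext f z
    simp [principalSeriesOp, rot_inv, iwasawaH_rot, iwasawaK_rot]
  map_mul' x y := by
    ext f z
    have h : (x * y)⁻¹ * (rot z)⁻¹ = y⁻¹ * (x⁻¹ * (rot z)⁻¹) := by group
    simp only [principalSeriesOp, LinearMap.coe_mk, AddHom.coe_mk, ContinuousMap.coe_mk,
      Module.End.mul_apply, h]
    rw [iwasawaH_mul y⁻¹, iwasawaK_mul y⁻¹, rot_inv (iwasawaK _)⁻¹, inv_inv, ← mul_assoc,
      ← Complex.exp_add]
    push_cast
    ring_nf

lemma principalSeries_apply (lam : ℂ) (x : SL2R) (f : C(Circle, ℂ)) (z : Circle) :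
    principalSeries lam x f z =
      Complex.exp ((Complex.I * lam - 1) * (iwasawaH (x⁻¹ * (rot z)⁻¹) : ℂ)) *
        f (iwasawaK (x⁻¹ * (rot z)⁻¹))⁻¹ := rfl

/-- The character `e_n(k_θ) = e^{inθ}` of `K`. -/
def char (n : ℤ) : C(Circle, ℂ) where
  toFun z := (z : ℂ) ^ n
  continuous_toFun :=
    (continuous_subtype_val.comp (continuous_zpow n) : Continuous fun z : Circle => (z ^ n : Circle).1)

/-- The coefficient `⟨f, e_m⟩ = ∫_K f(k) e_m(k)^* dk` with respect to the Haar measure of `K` of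
total mass one. -/
def kCoeff (f : C(Circle, ℂ)) (m : ℤ) : ℂ :=
  (1 / (2 * Real.pi) : ℝ) * ∫ θ in (0 : ℝ)..(2 * Real.pi),
    f (Circle.exp θ) * (starRingEnd ℂ) (char m (Circle.exp θ))

/-! ### The discrete series -/

/-- The set `Z(k)` of `K`-types of `π_{ik}`, for `k ≠ 0`: the integers `m` of parity opposite to
that of `k`, with `m ≥ k + 1` if `k ≥ 1` and `m ≤ k - 1` if `k ≤ -1`. -/
def kTypes (k : ℤ) : Set ℤ :=
  if 1 ≤ k then {m | Odd (m - k) ∧ k + 1 ≤ m} else {m | Odd (m - k) ∧ m ≤ k - 1}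

/-- The closed span of the `e_m`, `m ∈ Z(k)`, in the continuous functions on `K`. -/
def discreteSpace (k : ℤ) : Submodule ℂ C(Circle, ℂ) :=
  (Submodule.span ℂ (char '' kTypes k)).topologicalClosure

lemma char_mem {k m : ℤ} (hm : m ∈ kTypes k) : char m ∈ discreteSpace k :=
  Submodule.le_topologicalClosure _ (Submodule.subset_span ⟨m, hm, rfl⟩)

section Invariance

/-- The complex number `p + i q`, where `(p, q)` is the first column of `x⁻¹ k_z⁻¹`. -/
def colNum (x : SL2R) (z : Circle) : ℂ :=
  ((x⁻¹ * (rot z)⁻¹) 0 0 : ℂ) + Complex.I * ((x⁻¹ * (rot z)⁻¹) 1 0 : ℂ)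

lemma colNum_eq (x : SL2R) : ∃ a b : ℂ, ‖b‖ < ‖a‖ ∧ ∀ z : Circle,
    colNum x z = (z : ℂ)⁻¹ * (a * (z : ℂ) ^ 2 + b) := by
  have hd := x.det_coe
  rw [Matrix.det_fin_two] at hd
  refine ⟨⟨(x 0 0 + x 1 1) / 2, (x 0 1 - x 1 0) / 2⟩, ⟨(x 1 1 - x 0 0) / 2, -(x 0 1 + x 1 0) / 2⟩,
    ?_, fun z => ?_⟩
  · rw [Complex.norm_def, Complex.norm_def]
    apply Real.sqrt_lt_sqrt (Complex.normSq_nonneg _)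
    simp only [Complex.normSq_apply]
    nlinarith
  · have hz := Circle.coe_ne_zero z
    have hc : (z : ℂ)⁻¹ = (starRingEnd ℂ) (z : ℂ) := by
      rw [← Circle.coe_inv, Circle.coe_inv_eq_conj]
    have e : (z : ℂ)⁻¹ * ((⟨(x 0 0 + x 1 1) / 2, (x 0 1 - x 1 0) / 2⟩ : ℂ) * (z : ℂ) ^ 2 +
        ⟨(x 1 1 - x 0 0) / 2, -(x 0 1 + x 1 0) / 2⟩) =
        (⟨(x 0 0 + x 1 1) / 2, (x 0 1 - x 1 0) / 2⟩ : ℂ) * z +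
        ⟨(x 1 1 - x 0 0) / 2, -(x 0 1 + x 1 0) / 2⟩ * (z : ℂ)⁻¹ := by
      field_simp
    have i00 : x⁻¹ 0 0 = x 1 1 := by
      rw [Matrix.SpecialLinearGroup.coe_inv, Matrix.adjugate_fin_two]; rfl
    have i01 : x⁻¹ 0 1 = -x 0 1 := by
      rw [Matrix.SpecialLinearGroup.coe_inv, Matrix.adjugate_fin_two]; rfl
    have i10 : x⁻¹ 1 0 = -x 1 0 := by
      rw [Matrix.SpecialLinearGroup.coe_inv, Matrix.adjugate_fin_two]; rfl
    have i11 : x⁻¹ 1 1 = x 0 0 := by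
      rw [Matrix.SpecialLinearGroup.coe_inv, Matrix.adjugate_fin_two]; rfl
    have r0 : rot z⁻¹ 0 0 = (z : ℂ).re := by
      have : rot z⁻¹ 0 0 = ((z⁻¹ : Circle) : ℂ).re := rfl
      rw [this, Circle.coe_inv_eq_conj, Complex.conj_re]
    have r1 : rot z⁻¹ 1 0 = (z : ℂ).im := by
      have : rot z⁻¹ 1 0 = -((z⁻¹ : Circle) : ℂ).im := rfl
      rw [this, Circle.coe_inv_eq_conj, Complex.conj_im, neg_neg]
    rw [e, hc, colNum, rot_inv, mul_entry x⁻¹, mul_entry x⁻¹, i00, i01, i10, i11, r0, r1]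
    apply Complex.ext <;> simp <;> ring

lemma principalSeries_char (K : ℕ) (j : ℕ) (x : SL2R) (z : Circle) :
    principalSeries (Complex.I * K) x (char (K + 1 + 2 * j)) z =
      colNum x z ^ j * ((starRingEnd ℂ) (colNum x z))⁻¹ ^ (K + 1 + j) := by
  set g := x⁻¹ * (rot z)⁻¹ with hg
  have hr : (0 : ℝ) < √(g 0 0 ^ 2 + g 1 0 ^ 2) := Real.sqrt_pos.2 (col_pos g)
  set r := √(g 0 0 ^ 2 + g 1 0 ^ 2) with hrdef
  have hr2 : r ^ 2 = g 0 0 ^ 2 + g 1 0 ^ 2 := Real.sq_sqrt (col_pos g).le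
  have hrc : (r : ℂ) ≠ 0 := Complex.ofReal_ne_zero.2 hr.ne'
  set w := colNum x z with hw
  have hwdef : w = (g 0 0 : ℂ) + Complex.I * (g 1 0 : ℂ) := rfl
  have hcw : (starRingEnd ℂ) w = (g 0 0 : ℂ) - Complex.I * (g 1 0 : ℂ) := by
    rw [hwdef]; simp [sub_eq_add_neg]
  have hww : w * (starRingEnd ℂ) w = (r : ℂ) ^ 2 := by
    rw [hcw, hwdef, ← Complex.ofReal_pow, hr2]
    push_cast
    linear_combination (-(g 1 0 : ℂ) ^ 2) * Complex.I_sq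
  have hcw0 : (starRingEnd ℂ) w ≠ 0 := by
    intro h0
    rw [h0, mul_zero] at hww
    exact pow_ne_zero 2 hrc hww.symm
  have hK : ((iwasawaK g)⁻¹ : ℂ) = w / r := by
    have h1 : (iwasawaK g : ℂ) = (starRingEnd ℂ) w / r := by rw [hcw]; rfl
    rw [h1, inv_div, div_eq_div_iff hcw0 hrc, hww, pow_two]
  have hexp : Complex.exp ((Complex.I * (Complex.I * K) - 1) * (iwasawaH g : ℂ)) =
      ((r : ℂ) ^ (K + 1))⁻¹ := by
    have h1 : Complex.exp (iwasawaH g : ℂ) = r := by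
      rw [← Complex.ofReal_exp, exp_iwasawaH]
    rw [← h1, ← Complex.exp_nat_mul, ← Complex.exp_neg]
    congr 1
    push_cast
    linear_combination ((K : ℂ) * (iwasawaH g : ℂ)) * Complex.I_sq
  have hch : char (K + 1 + 2 * j) (iwasawaK g)⁻¹ = (w / r) ^ (K + 1 + 2 * j) := by
    have : char (K + 1 + 2 * j) (iwasawaK g)⁻¹ =
      (((iwasawaK g)⁻¹ : Circle) : ℂ) ^ ((K + 1 + 2 * j : ℕ) : ℤ) := by
        push_cast; rfl
    rw [this, zpow_natCast, Circle.coe_inv, hK]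
  rw [principalSeries_apply, hexp, hch]
  have h3 : ((starRingEnd ℂ) w)⁻¹ = w / (r : ℂ) ^ 2 := by
    rw [← hww]
    field_simp
    rw [div_self]
    intro h0
    rw [h0, zero_mul] at hww
    exact pow_ne_zero 2 hrc hww.symm
  rw [h3, div_pow, div_pow, inv_mul_eq_div, div_div, ← mul_div_assoc,
    div_eq_div_iff (by positivity) (by positivity)]
  ring

lemma conj_colNum (z : Circle) (a b : ℂ) :
    (starRingEnd ℂ) ((z : ℂ)⁻¹ * (a * (z : ℂ) ^ 2 + b)) =
      (z : ℂ)⁻¹ * ((starRingEnd ℂ) a + (starRingEnd ℂ) b * (z : ℂ) ^ 2) := by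
  have hz := Circle.coe_ne_zero z
  have hc : (starRingEnd ℂ) (z : ℂ) = (z : ℂ)⁻¹ := by
    rw [← Circle.coe_inv, Circle.coe_inv_eq_conj]
  rw [map_mul, map_inv₀, map_add, map_mul, map_pow, hc]
  field_simp

lemma char_apply (n : ℤ) (z : Circle) : char n z = (z : ℂ) ^ n := rfl

lemma norm_char_le (n : ℤ) : ‖char n‖ ≤ 1 := by
  rw [ContinuousMap.norm_le _ zero_le_one]
  intro z
  rw [char_apply, norm_zpow, Circle.norm_coe, one_zpow]

/-- The closed algebra generated by `e_2`. -/
def polyAlg : Subalgebra ℂ C(Circle, ℂ) := (Algebra.adjoin ℂ {char 2}).topologicalClosure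

lemma isClosed_polyAlg : IsClosed (polyAlg : Set C(Circle, ℂ)) :=
  Subalgebra.isClosed_topologicalClosure _

lemma char_two_mem : char 2 ∈ polyAlg :=
  Subalgebra.le_topologicalClosure _ (Algebra.subset_adjoin rfl)

lemma char_mul_mem (K : ℕ) {g : C(Circle, ℂ)} (hg : g ∈ polyAlg) :
    char (K + 1) * g ∈
      (Submodule.span ℂ (Set.range fun i : ℕ => char (K + 1 + 2 * i))).topologicalClosure := by
  refine map_mem_closure (continuous_const_mul (char (K + 1))) hg ?_
  intro f hf
  rw [Algebra.adjoin_singleton_eq_range_aeval] at hf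
  obtain ⟨P, rfl⟩ := hf
  show char (K + 1) * Polynomial.aeval (char 2) P ∈ Submodule.span ℂ _
  rw [Polynomial.aeval_eq_sum_range, Finset.mul_sum]
  refine Submodule.sum_mem _ fun i _ => ?_
  have : char (K + 1) * P.coeff i • char 2 ^ i = P.coeff i • char (K + 1 + 2 * i) := by
    ext z
    have hz := Circle.coe_ne_zero z
    simp only [ContinuousMap.mul_apply, ContinuousMap.smul_apply, ContinuousMap.pow_apply,
      char_apply, smul_eq_mul]
    rw [zpow_add₀ hz (K + 1 : ℤ), zpow_mul, zpow_natCast]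
    ring
  rw [this]
  exact Submodule.smul_mem _ _ (Submodule.subset_span ⟨i, rfl⟩)

lemma exists_inv (a b : ℂ) (h : ‖b‖ < ‖a‖) :
    ∃ v ∈ polyAlg, ∀ z : Circle,
      v z = (a + b * (z : ℂ) ^ 2)⁻¹ := by
  have ha : a ≠ 0 := by
    rintro rfl
    simp at h
    exact absurd h (not_lt.2 (norm_nonneg b))
  set q : C(Circle, ℂ) := (-(b / a)) • char 2 with hq
  have hq1 : ‖q‖ < 1 := by
    rw [hq, norm_smul, norm_neg, norm_div]
    have h1 : ‖b‖ / ‖a‖ < 1 := (div_lt_one (norm_pos_iff.2 ha)).2 h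
    have h2 := norm_char_le 2
    have h3 : 0 ≤ ‖b‖ / ‖a‖ := by positivity
    nlinarith
  have hs := summable_geometric_of_norm_lt_one hq1
  have hqA : q ∈ polyAlg := polyAlg.smul_mem char_two_mem _
  have hmem : (∑' n : ℕ, q ^ n) ∈ polyAlg := by
    refine isClosed_polyAlg.mem_of_tendsto hs.hasSum ?_
    exact Filter.Eventually.of_forall fun t =>
      polyAlg.sum_mem fun i _ => polyAlg.pow_mem hqA i
  refine ⟨a⁻¹ • ∑' n : ℕ, q ^ n, polyAlg.smul_mem hmem _, fun z => ?_⟩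
  have h1 : (1 - q) * ∑' n : ℕ, q ^ n = 1 := mul_neg_geom_series q hq1
  have h2 := congrArg (fun f : C(Circle, ℂ) => f z) h1
  have h4 : q z = -(b / a) * (z : ℂ) ^ 2 := by
    simp [hq, char_apply]
  simp only [ContinuousMap.mul_apply, ContinuousMap.sub_apply, ContinuousMap.one_apply, h4] at h2
  rw [ContinuousMap.smul_apply, smul_eq_mul]
  refine eq_inv_of_mul_eq_one_right ?_
  rw [← h2]
  field_simp
  ring

lemma principalSeries_char_mem (K j : ℕ) (x : SL2R) :
    principalSeries (Complex.I * K) x (char (K + 1 + 2 * j)) ∈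
      (Submodule.span ℂ (Set.range fun i : ℕ => char (K + 1 + 2 * i))).topologicalClosure := by
  obtain ⟨a, b, hab, hcol⟩ := colNum_eq x
  obtain ⟨v, hv, hvz⟩ := exists_inv ((starRingEnd ℂ) a) ((starRingEnd ℂ) b) (by simpa using hab)
  have hmem : (a • char 2 + b • 1) ^ j * v ^ (K + 1 + j) ∈ polyAlg := by
    have h1 : a • char 2 + b • 1 ∈ polyAlg :=
      polyAlg.add_mem (polyAlg.smul_mem char_two_mem _) (polyAlg.smul_mem polyAlg.one_mem _)
    exact polyAlg.mul_mem (polyAlg.pow_mem h1 _) (polyAlg.pow_mem hv _)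
  have he : principalSeries (Complex.I * K) x (char (K + 1 + 2 * j)) =
      char (K + 1) * ((a • char 2 + b • 1) ^ j * v ^ (K + 1 + j)) := by
    ext z
    have hz := Circle.coe_ne_zero z
    rw [principalSeries_char, hcol, conj_colNum]
    simp only [ContinuousMap.mul_apply, ContinuousMap.pow_apply, ContinuousMap.add_apply,
      ContinuousMap.smul_apply, ContinuousMap.one_apply, smul_eq_mul, hvz, char_apply]
    rw [mul_inv, inv_inv]
    have hk : (z : ℂ) ^ ((K : ℤ) + 1) = (z : ℂ) ^ (K + 1) := by
      rw [← zpow_natCast]; norm_cast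
    have h2 : (z : ℂ) ^ (2 : ℤ) = (z : ℂ) ^ 2 := by norm_cast
    rw [hk, h2, mul_pow, mul_pow, mul_one, pow_add _ (K + 1) j, inv_pow]
    field_simp
  rw [he]
  exact char_mul_mem K hmem

lemma continuous_principalSeries (lam : ℂ) (x : SL2R) : Continuous (principalSeries lam x) := by
  let m : C(Circle, ℂ) :=
    ⟨fun z => Complex.exp ((Complex.I * lam - 1) * (iwasawaH (x⁻¹ * (rot z)⁻¹) : ℂ)), by
      have h := continuous_iwasawaH
      have h2 := continuous_rot
      fun_prop⟩
  let c : C(Circle, Circle) := ⟨fun z => (iwasawaK (x⁻¹ * (rot z)⁻¹))⁻¹, by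
      have h := continuous_iwasawaK
      have h2 := continuous_rot
      fun_prop⟩
  have h : (principalSeries lam x : C(Circle, ℂ) → C(Circle, ℂ)) = fun f => m * f.comp c := rfl
  rw [h]
  exact continuous_const.mul (ContinuousMap.continuous_precomp c)

lemma star_char (n : ℤ) : star (char n) = char (-n) := by
  ext z
  rw [ContinuousMap.star_apply, char_apply, char_apply, star_zpow₀, zpow_neg, ← inv_zpow]
  congr 1
  rw [← Circle.coe_inv, Circle.coe_inv_eq_conj]
  rfl

lemma star_principalSeries (K : ℕ) (x : SL2R) (f : C(Circle, ℂ)) :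
    star (principalSeries (Complex.I * K) x f) = principalSeries (Complex.I * K) x (star f) := by
  ext z
  rw [ContinuousMap.star_apply, principalSeries_apply, principalSeries_apply, star_mul',
    ContinuousMap.star_apply]
  congr 1
  rw [← mul_assoc, Complex.I_mul_I]
  change (starRingEnd ℂ) _ = _
  rw [← Complex.exp_conj]
  simp

lemma star_mem (K : ℕ) {f : C(Circle, ℂ)}
    (hf : f ∈
      (Submodule.span ℂ (Set.range fun i : ℕ => char (K + 1 + 2 * i))).topologicalClosure) :
    star f ∈
      (Submodule.span ℂ (Set.range fun i : ℕ => char (-(K + 1 + 2 * i)))).topologicalClosure := by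
  refine map_mem_closure continuous_star hf ?_
  intro g hg
  refine Submodule.span_induction ?_ ?_ ?_ ?_ hg
  · rintro _ ⟨i, rfl⟩
    dsimp only
    rw [star_char]
    exact Submodule.subset_span ⟨i, rfl⟩
  · rw [star_zero]; exact Submodule.zero_mem _
  · intro u v _ _ hu hv
    rw [star_add]; exact Submodule.add_mem _ hu hv
  · intro c u _ hu
    rw [star_smul]; exact Submodule.smul_mem _ _ hu

/-- The closed span of the `e_m`, `m ∈ Z(k)`, is stable under `π_{i|k|}`. -/
lemma discreteSpace_stable (k : ℤ) (x : SL2R) {f : C(Circle, ℂ)} (hf : f ∈ discreteSpace k) :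
    principalSeries (Complex.I * (|k| : ℤ)) x f ∈ discreteSpace k := by
  obtain ⟨K, hK⟩ : ∃ K : ℕ, |k| = K := ⟨k.natAbs, Int.abs_eq_natAbs k⟩
  rw [hK, Int.cast_natCast]
  have hcl : IsClosed (discreteSpace k : Set C(Circle, ℂ)) :=
    Submodule.isClosed_topologicalClosure _
  suffices h : Submodule.span ℂ (char '' kTypes k) ≤
      (discreteSpace k).comap (principalSeries (Complex.I * K) x) from
    closure_minimal h (hcl.preimage (continuous_principalSeries _ x)) hf
  rw [Submodule.span_le]
  rintro _ ⟨m, hm, rfl⟩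
  show principalSeries (Complex.I * K) x (char m) ∈ discreteSpace k
  unfold kTypes at hm
  split_ifs at hm with hk
  · obtain ⟨⟨s, hs⟩, hm2⟩ := hm
    have hKk : k = K := by rw [← hK, abs_of_pos (by omega)]
    obtain ⟨j, rfl⟩ : ∃ j : ℕ, m = K + 1 + 2 * j := ⟨s.toNat, by omega⟩
    refine Submodule.topologicalClosure_mono (Submodule.span_mono ?_)
      (principalSeries_char_mem K j x)
    rintro _ ⟨i, rfl⟩
    refine ⟨_, ?_, rfl⟩
    rw [kTypes, if_pos hk]
    exact ⟨⟨i, by omega⟩, by omega⟩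
  · obtain ⟨⟨s, hs⟩, hm2⟩ := hm
    have hKk : k = -K := by rw [← hK, abs_of_nonpos (by omega), neg_neg]
    obtain ⟨j, rfl⟩ : ∃ j : ℕ, m = -(K + 1 + 2 * j) := ⟨(-s - 1).toNat, by omega⟩
    rw [← star_char, ← star_principalSeries]
    refine Submodule.topologicalClosure_mono (Submodule.span_mono ?_)
      (star_mem K (principalSeries_char_mem K j x))
    rintro _ ⟨i, rfl⟩
    refine ⟨_, ?_, rfl⟩
    rw [kTypes, if_neg hk]
    exact ⟨⟨-i - 1, by omega⟩, by omega⟩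

end Invariance

/-- The discrete series representation `π_{ik}`, `k ≠ 0`, as a subrepresentation of `π_{i|k|}`. -/
def discreteSeriesSub (k : ℤ) :
    Subrepresentation (principalSeries (Complex.I * (|k| : ℤ))) where
  toSubmodule := discreteSpace k
  apply_mem_toSubmodule x _ hf := discreteSpace_stable k x hf

/-- The discrete series representation `π_{ik}`, `k ≠ 0`, on the space `discreteSpace k`, which is
dense in its Hilbert space `H_k`. -/
def discreteSeries (k : ℤ) : Representation ℂ SL2R (discreteSpace k) :=
  (discreteSeriesSub k).toRepresentation

/-- The squared norm `⟨e_m, e_m⟩_k = j! |k|! / (j + |k|)!` of `e_m`, where `|m| = |k| + 1 + 2j`, for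
the inner product that makes `π_{ik}` unitary. (Unitarity fixes it up to one constant factor, which
is chosen here so that `e_m` has norm one for the lowest `|m| = |k| + 1`.) -/
def typeWeight (k m : ℤ) : ℝ :=
  let j := (m.natAbs - k.natAbs - 1) / 2
  (j.factorial * k.natAbs.factorial : ℝ) / ((j + k.natAbs).factorial : ℝ)

/-- The renormalized inner product `⟨f, g⟩_k`, linear in `f` and conjugate linear in `g`, for which
the `e_m`, `m ∈ Z(k)`, are orthogonal with `⟨e_m, e_m⟩_k = typeWeight k m`. -/
def renormInner (k : ℤ) (f g : discreteSpace k) : ℂ :=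
  ∑' m : kTypes k, (typeWeight k m : ℂ) * kCoeff f.1 m * (starRingEnd ℂ) (kCoeff g.1 m)

/-- The renormalized basis `e_n^k = e_n / ‖e_n‖_k`, `n ∈ Z(k)`. -/
def renormBasis (k : ℤ) (n : kTypes k) : discreteSpace k :=
  ((1 / √(typeWeight k n) : ℝ) : ℂ) • ⟨char n, char_mem n.2⟩

/-- The canonical matrix coefficient `ψ^{n,n}_{ik}(x) = ⟨π_{ik}(x) e_n^k, e_n^k⟩_k`. -/
def discreteCoeff (k : ℤ) (n : kTypes k) (x : SL2R) : ℂ :=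
  renormInner k (discreteSeries k x (renormBasis k n)) (renormBasis k n)

end SL2R

end

noncomputable section

/-! Identify `ℝ²` with `ℂ` and write `x` as `w ↦ A w + B w̄`, with `C` the conjugate of `B`; then
`|A|² - |C|² = 1`. Put `K = |k|` and `|n| = K + 1 + 2j`. On the circle `π_{iK}(x) e_n` (for `k > 0`;
the case `k < 0` is its complex conjugate) is a polynomial in `z²` times a negative power of `1 -
(C/A) z²`. Reading off one Fourier coefficient gives `Ā^j A^{-(j+K+1)} P(|C|²/|A|²)` with `P` a
Jacobi polynomial (`kCoeff_principalSeries`).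

Set `u = |A|²`. The argument of `P` is `1 - 1/u`, and `P(1) ≠ 0` (`jacobiPolySum_one_ne_zero`), so
`ψ` is of exact order `u^{-β}` at infinity with `β = (|k| + 1)/2` (`discreteCoeff_estimates`). The
Haar measure of `{u ≤ T}` is of exact order `T` for large `T` (`haar_growth`). Hence the
distribution function of `ψ` is of exact order `α^{-1/β}` as `α → 0`, while `ψ` is bounded. Weak
`L^p` therefore means `1/β ≤ p`, that is `|k| ≥ 2/p - 1`; at equality and for finite `q` the Lorentz
integral diverges like `∫ dα/α` at `0` (`memLorentz_iff_of_growth`).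

For the volume growth, Haar measure is realised by assigning to a set the Lebesgue volume of the
part of the cone over it where the determinant is at most one. In the coordinates `(A, C)` the
volumes needed are those of annuli fibred over annuli. -/

/-- The Jacobi polynomial `∑ i, C(j, i) C(N + i, N) (-s)^i`. -/
def jacobiPolySum (N j : ℕ) (s : ℝ) : ℝ :=
  ∑ i ∈ Finset.range (j + 1), (j.choose i : ℝ) * ((N + i).choose N : ℝ) * (-s) ^ i

lemma continuous_jacobiPolySum (N j : ℕ) : Continuous (jacobiPolySum N j) := by
  unfold jacobiPolySum
  fun_prop

/-- Up to the sign `(-1)^j` the value is the `j`-th forward difference of `y ↦ C(y, j + K)` at `y =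
j + K`. Each difference lowers the lower index by one, which leaves `C(j + K, K) > 0`. -/
lemma jacobiPolySum_one_ne_zero (K j : ℕ) : jacobiPolySum (j + K) j 1 ≠ 0 := by
  have h := congrFun (fwdDiff_iter_choose K j) (j + K)
  rw [fwdDiff_iter_eq_sum_shift] at h
  have h2 : (-1 : ℝ) ^ j * jacobiPolySum (j + K) j 1 = ((j + K).choose K : ℝ) := by
    have h3 := congrArg (Int.cast : ℤ → ℝ) h
    push_cast at h3
    rw [← h3, jacobiPolySum, Finset.mul_sum]
    refine Finset.sum_congr rfl fun i hi => ?_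
    have hij : i ≤ j := Nat.lt_succ_iff.1 (Finset.mem_range.1 hi)
    have hs : (-1 : ℝ) ^ j * (-1) ^ i = (-1) ^ (j - i) := by
      conv_lhs => rw [← Nat.sub_add_cancel hij]
      rw [pow_add, mul_assoc, ← pow_add, ← two_mul, pow_mul]
      simp
    simp only [smul_eq_mul, mul_one]
    push_cast
    rw [← hs]
    ring
  intro h0
  rw [h0, mul_zero] at h2
  have := Nat.choose_pos (Nat.le_add_left K j)
  exact this.ne' (by exact_mod_cast h2.symm)

namespace SL2R

/-! ### Fourier coefficients -/

lemma kCoeff_integrand_integrable (f : C(Circle, ℂ)) (m : ℤ) :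
    IntervalIntegrable (fun θ : ℝ => f (Circle.exp θ) * (starRingEnd ℂ) (char m (Circle.exp θ)))
      volume 0 (2 * Real.pi) := by
  apply Continuous.intervalIntegrable
  exact (by fun_prop)

/-- The Fourier coefficient as a continuous linear functional. -/
def kCoeffCLM (m : ℤ) : C(Circle, ℂ) →L[ℂ] ℂ :=
  LinearMap.mkContinuous
    { toFun := fun f => kCoeff f m
      map_add' := fun f g => by
        rw [kCoeff, kCoeff, kCoeff, ← mul_add, ← intervalIntegral.integral_add
          (kCoeff_integrand_integrable f m) (kCoeff_integrand_integrable g m)]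
        simp only [ContinuousMap.add_apply, add_mul]
      map_smul' := fun c f => by
        simp only [kCoeff, ContinuousMap.smul_apply, smul_eq_mul, RingHom.id_apply, mul_assoc,
          intervalIntegral.integral_const_mul]
        ring } 1 (fun f => by
    have hpi := Real.pi_pos
    have h : ‖∫ θ in (0 : ℝ)..(2 * Real.pi),
        f (Circle.exp θ) * (starRingEnd ℂ) (char m (Circle.exp θ))‖ ≤
        ‖f‖ * |2 * Real.pi - 0| := by
      apply intervalIntegral.norm_integral_le_of_norm_le_const
      intro θ _
      rw [norm_mul, RCLike.norm_conj]
      have h1 := f.norm_coe_le_norm (Circle.exp θ)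
      have h2 := ((char m).norm_coe_le_norm (Circle.exp θ)).trans (norm_char_le m)
      nlinarith [norm_nonneg (f (Circle.exp θ))]
    rw [sub_zero, abs_of_pos (by positivity)] at h
    show ‖kCoeff f m‖ ≤ _
    rw [kCoeff, norm_mul, Complex.norm_real, Real.norm_of_nonneg (by positivity), one_mul]
    calc _ ≤ 1 / (2 * Real.pi) * (‖f‖ * (2 * Real.pi)) := by gcongr
      _ = ‖f‖ := by field_simp)

lemma kCoeffCLM_apply (m : ℤ) (f : C(Circle, ℂ)) : kCoeffCLM m f = kCoeff f m := rfl

lemma kCoeff_char (m n : ℤ) : kCoeff (char m) n = if m = n then 1 else 0 := by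
  have hpi := Real.pi_pos
  have hi : ∀ θ : ℝ, char m (Circle.exp θ) * (starRingEnd ℂ) (char n (Circle.exp θ)) =
      Complex.exp (((m - n : ℤ) * Complex.I) * θ) := by
    intro θ
    rw [char_apply, char_apply, map_zpow₀, ← Circle.coe_inv_eq_conj, Circle.coe_inv, inv_zpow,
      ← zpow_neg, ← zpow_add₀ (Circle.coe_ne_zero _), Circle.coe_exp, ← Complex.exp_int_mul]
    push_cast
    ring_nf
  simp only [kCoeff, hi]
  split_ifs with h
  · subst h
    simp
    field_simp
  · have hc : ((m - n : ℤ) * Complex.I : ℂ) ≠ 0 :=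
      mul_ne_zero (by exact_mod_cast sub_ne_zero.2 h) Complex.I_ne_zero
    rw [integral_exp_mul_complex hc]
    have : Complex.exp ((m - n : ℤ) * Complex.I * (2 * Real.pi : ℝ)) = 1 := by
      rw [Complex.exp_eq_one_iff]
      exact ⟨m - n, by push_cast; ring⟩
    rw [this]
    simp

lemma kCoeff_star (f : C(Circle, ℂ)) (m : ℤ) :
    kCoeff (star f) (-m) = (starRingEnd ℂ) (kCoeff f m) := by
  rw [kCoeff, kCoeff, map_mul, Complex.conj_ofReal,
    intervalIntegral.integral_of_le Real.two_pi_pos.le,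
    intervalIntegral.integral_of_le Real.two_pi_pos.le, ← integral_conj]
  congr 2
  ext θ
  simp only [← star_char, ContinuousMap.star_apply, map_mul]
  rfl

lemma char_mul_char (m n : ℤ) : char m * char n = char (m + n) := by
  ext z
  rw [ContinuousMap.mul_apply, char_apply, char_apply, char_apply,
    zpow_add₀ (Circle.coe_ne_zero z)]

/-- The Taylor expansion of `(1 - r z²)^{-(N+1)}` on the circle. -/
lemma exists_binomial_series (N : ℕ) {r : ℂ} (hr : ‖r‖ < 1) : ∃ S : C(Circle, ℂ),
    HasSum (fun i : ℕ => (((i + N).choose N : ℂ) * r ^ i) • char (2 * i)) S ∧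
    ∀ z : Circle, S z = ((1 - r * (z : ℂ) ^ 2) ^ (N + 1))⁻¹ := by
  have hs : Summable fun i : ℕ => (((i + N).choose N : ℂ) * r ^ i) • char (2 * i) := by
    have h := (hasSum_choose_mul_geometric_of_norm_lt_one N
      (r := ‖r‖) (by simpa using hr)).summable
    refine Summable.of_norm_bounded h fun i => ?_
    rw [norm_smul, norm_mul, norm_pow, Complex.norm_natCast]
    exact mul_le_of_le_one_right (by positivity) (norm_char_le _)
  refine ⟨_, hs.hasSum, fun z => ?_⟩
  have h1 := hs.hasSum.mapL (ContinuousMap.evalCLM ℂ z)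
  have h2 := hasSum_choose_mul_geometric_of_norm_lt_one N (r := r * (z : ℂ) ^ 2) (by
    rw [norm_mul, norm_pow, Circle.norm_coe, one_pow, mul_one]; exact hr)
  rw [one_div] at h2
  refine HasSum.unique (f := fun i : ℕ => ((i + N).choose N : ℂ) * (r * (z : ℂ) ^ 2) ^ i) ?_ h2
  refine Eq.subst (motive := fun g => HasSum g _) (funext fun i => ?_) h1
  simp only [ContinuousMap.evalCLM_apply, ContinuousMap.smul_apply, char_apply, smul_eq_mul,
    zpow_mul, zpow_natCast, zpow_ofNat, mul_pow, mul_assoc]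

/-- The coefficient functional is continuous, so it passes inside the series, where orthogonality of
characters keeps a single term. -/
lemma kCoeff_char_mul_series {N : ℕ} {r : ℂ} {S : C(Circle, ℂ)}
    (hS : HasSum (fun i : ℕ => (((i + N).choose N : ℂ) * r ^ i) • char (2 * i)) S) (m : ℤ) (i : ℕ) :
    kCoeff (char m * S) (m + 2 * i) = ((i + N).choose N : ℂ) * r ^ i := by
  have h := (hS.mul_left (char m)).mapL (kCoeffCLM (m + 2 * i))
  rw [kCoeffCLM_apply] at h
  refine h.unique ?_
  have h3 : ∀ l : ℕ, kCoeffCLM (m + 2 * i) (char m * (((l + N).choose N : ℂ) * r ^ l) • char (2 * l)) =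
      if l = i then ((l + N).choose N : ℂ) * r ^ l else 0 := by
    intro l
    rw [mul_smul_comm, char_mul_char, map_smul, kCoeffCLM_apply, kCoeff_char, smul_eq_mul]
    by_cases hl : l = i
    · simp [hl]
    · rw [if_neg hl, if_neg (by omega), mul_zero]
  simp only [h3]
  have := hasSum_ite_eq i (((i + N).choose N : ℂ) * r ^ i)
  convert this using 2 with l
  split_ifs with hl
  · rw [hl]
  · rfl

/-! ### Closed formula for the matrix coefficients -/

/-- The `A`-coordinate of `x`, where `x` acts on `ℝ² = ℂ` by `w ↦ A w + B w̄`. -/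
def coordA (x : SL2R) : ℂ := ⟨(x 0 0 + x 1 1) / 2, (x 1 0 - x 0 1) / 2⟩

/-- The conjugate of the `B`-coordinate of `x`, where `x` acts on `ℝ² = ℂ` by `w ↦ A w + B w̄`. -/
def coordC (x : SL2R) : ℂ := ⟨(x 0 0 - x 1 1) / 2, -(x 1 0 + x 0 1) / 2⟩

/-- The left side is the determinant of `x` written in the coordinates `(A, C)`. -/
lemma normSq_coord (x : SL2R) :
    Complex.normSq (coordA x) - Complex.normSq (coordC x) = 1 := by
  have hd := x.det_coe
  rw [Matrix.det_fin_two] at hd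
  simp only [coordA, coordC, Complex.normSq_mk]
  linarith

lemma colNum_eq_coord (x : SL2R) (z : Circle) :
    colNum x z =
      (z : ℂ)⁻¹ * ((starRingEnd ℂ) (coordA x) * (z : ℂ) ^ 2 - (starRingEnd ℂ) (coordC x)) := by
  have hz := Circle.coe_ne_zero z
  have hc : (z : ℂ)⁻¹ = (starRingEnd ℂ) (z : ℂ) := by
    rw [← Circle.coe_inv, Circle.coe_inv_eq_conj]
  have e : (z : ℂ)⁻¹ * ((starRingEnd ℂ) (coordA x) * (z : ℂ) ^ 2 - (starRingEnd ℂ) (coordC x)) =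
      (starRingEnd ℂ) (coordA x) * z - (starRingEnd ℂ) (coordC x) * (z : ℂ)⁻¹ := by
    field_simp
  have i00 : x⁻¹ 0 0 = x 1 1 := by
    rw [Matrix.SpecialLinearGroup.coe_inv, Matrix.adjugate_fin_two]; rfl
  have i01 : x⁻¹ 0 1 = -x 0 1 := by
    rw [Matrix.SpecialLinearGroup.coe_inv, Matrix.adjugate_fin_two]; rfl
  have i10 : x⁻¹ 1 0 = -x 1 0 := by
    rw [Matrix.SpecialLinearGroup.coe_inv, Matrix.adjugate_fin_two]; rfl
  have i11 : x⁻¹ 1 1 = x 0 0 := by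
    rw [Matrix.SpecialLinearGroup.coe_inv, Matrix.adjugate_fin_two]; rfl
  have r0 : rot z⁻¹ 0 0 = (z : ℂ).re := by
    have : rot z⁻¹ 0 0 = ((z⁻¹ : Circle) : ℂ).re := rfl
    rw [this, Circle.coe_inv_eq_conj, Complex.conj_re]
  have r1 : rot z⁻¹ 1 0 = (z : ℂ).im := by
    have : rot z⁻¹ 1 0 = -((z⁻¹ : Circle) : ℂ).im := rfl
    rw [this, Circle.coe_inv_eq_conj, Complex.conj_im, neg_neg]
  rw [e, hc, colNum, rot_inv, mul_entry x⁻¹, mul_entry x⁻¹, i00, i01, i10, i11, r0, r1]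
  apply Complex.ext <;> simp [coordA, coordC] <;> ring

lemma coordA_ne_zero (x : SL2R) : coordA x ≠ 0 := by
  intro h
  have := normSq_coord x
  rw [h, map_zero] at this
  linarith [Complex.normSq_nonneg (coordC x)]

/-- The diagonal matrix coefficients of the holomorphic discrete series. -/
lemma kCoeff_principalSeries (K j : ℕ) (x : SL2R) :
    kCoeff (principalSeries (Complex.I * K) x (char (K + 1 + 2 * j))) (K + 1 + 2 * j) =
      (starRingEnd ℂ) (coordA x) ^ j * (coordA x ^ (j + K + 1))⁻¹ *
        (jacobiPolySum (j + K) j (Complex.normSq (coordC x) / Complex.normSq (coordA x)) : ℂ) := by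
  set A := coordA x with hA
  set C := coordC x with hC
  have hA0 : A ≠ 0 := coordA_ne_zero x
  have hr : ‖C / A‖ < 1 := by
    rw [norm_div, div_lt_one (norm_pos_iff.2 hA0)]
    have h := normSq_coord x
    rw [← hA, ← hC, Complex.normSq_eq_norm_sq, Complex.normSq_eq_norm_sq] at h
    exact lt_of_pow_lt_pow_left₀ 2 (norm_nonneg _) (by linarith)
  -- The conjugate of `colNum x z` is `z⁻¹ A (1 - (C/A) z²)`, and it occurs to the power `-(j + K +
  -- 1)`; hence the series with `N = j + K`. The other factor, `(Ā z² - C̄)^j`, is expanded by the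
  -- binomial theorem.
  obtain ⟨S, hS, hSz⟩ := exists_binomial_series (j + K) hr
  have hf : principalSeries (Complex.I * K) x (char (K + 1 + 2 * j)) =
      ∑ l ∈ Finset.range (j + 1), ((A ^ (j + K + 1))⁻¹ * (((starRingEnd ℂ) A) ^ l *
        (-(starRingEnd ℂ) C) ^ (j - l) * (j.choose l : ℂ))) • (char (K + 1 + 2 * l) * S) := by
    ext z
    have hz := Circle.coe_ne_zero z
    have hzz : (starRingEnd ℂ) (z : ℂ) = (z : ℂ)⁻¹ := by
      rw [← Circle.coe_inv, Circle.coe_inv_eq_conj]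
    have hcc : (starRingEnd ℂ) (colNum x z) = (z : ℂ)⁻¹ * (A * (1 - C / A * (z : ℂ) ^ 2)) := by
      rw [colNum_eq_coord, ← hA, ← hC]
      simp only [map_mul, map_sub, map_pow, map_inv₀, Complex.conj_conj, hzz]
      field_simp
    rw [principalSeries_char, hcc, colNum_eq_coord, ← hA, ← hC, ContinuousMap.sum_apply,
      sub_eq_add_neg, mul_pow, add_pow]
    simp only [ContinuousMap.smul_apply, ContinuousMap.mul_apply, char_apply, hSz, smul_eq_mul]
    rw [Finset.mul_sum, Finset.sum_mul]
    refine Finset.sum_congr rfl fun l _ => ?_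
    have e1 : (z : ℂ) ^ ((K : ℤ) + 1 + 2 * l) = (z : ℂ) ^ (K + 1) * ((z : ℂ) ^ 2) ^ l := by
      rw [← pow_mul, ← pow_add, ← zpow_natCast]; push_cast; rfl
    have e2 : K + 1 + j = j + K + 1 := by ring
    rw [e1, e2, mul_inv, mul_inv, inv_inv, mul_pow, mul_pow, mul_pow, inv_pow (_ - _), inv_pow A,
      inv_pow, show j + K + 1 = j + (K + 1) by ring, pow_add (z : ℂ)]
    field_simp
  have hlin : ∀ f : C(Circle, ℂ), kCoeff f (K + 1 + 2 * j) = kCoeffCLM (K + 1 + 2 * j) f :=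
    fun f => rfl
  -- Reflecting `l = j - i` makes `i` the degree in `z²` taken from the series; the term then
  -- contributes `Ā^j (-|C|²/|A|²)^i`.
  rw [hf, hlin, map_sum, ← Finset.sum_range_reflect, jacobiPolySum]
  push_cast
  rw [Finset.mul_sum]
  refine Finset.sum_congr rfl fun i hi => ?_
  have hij : i ≤ j := Nat.lt_succ_iff.1 (Finset.mem_range.1 hi)
  obtain ⟨l, rfl⟩ := Nat.exists_eq_add_of_le hij
  have e1 : i + l - i = l := by omega
  have e2 : i + l - l = i := by omega
  have e3 : ((K : ℤ) + 1 + 2 * (i + l : ℕ)) = ((K : ℤ) + 1 + 2 * l) + 2 * i := by push_cast; ring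
  have hAc : (starRingEnd ℂ) A ≠ 0 := (map_ne_zero _).2 hA0
  rw [e1, e2, map_smul, kCoeffCLM_apply, e3, kCoeff_char_mul_series hS, smul_eq_mul,
    ← Complex.mul_conj, ← Complex.mul_conj, Nat.choose_symm_add, add_comm i (i + l + K),
    neg_pow _ i, neg_pow (_ / _) i, div_pow, div_pow, mul_pow, mul_pow, pow_add _ i l]
  field_simp

/-- The powers of `|A|` depending on `j` cancel, so the decay rate is governed by `K` alone. -/
lemma norm_kCoeff_principalSeries (K j : ℕ) (x : SL2R) :
    ‖kCoeff (principalSeries (Complex.I * K) x (char (K + 1 + 2 * j))) (K + 1 + 2 * j)‖ =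
      (‖coordA x‖ ^ (K + 1))⁻¹ *
        |jacobiPolySum (j + K) j (Complex.normSq (coordC x) / Complex.normSq (coordA x))| := by
  have h := norm_pos_iff.2 (coordA_ne_zero x)
  rw [kCoeff_principalSeries, norm_mul, norm_mul, norm_pow, norm_inv, norm_pow, RCLike.norm_conj,
    Complex.norm_real, Real.norm_eq_abs, add_assoc, pow_add]
  field_simp

/-! ### Diagonal coefficients of the discrete series: reduction, continuity, decay -/

lemma typeWeight_pos (k m : ℤ) : 0 < typeWeight k m := by
  unfold typeWeight
  positivity

/-- Pairing with a multiple of `e_n` leaves one term of the inner product, in which the weight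
cancels against the two normalising factors. -/
lemma discreteCoeff_eq (k : ℤ) (n : kTypes k) (x : SL2R) :
    discreteCoeff k n x = kCoeff (principalSeries (Complex.I * (|k| : ℤ)) x (char n)) n := by
  have hw := typeWeight_pos k n
  set s : ℂ := ((1 / √(typeWeight k n) : ℝ) : ℂ) with hs
  have h1 : (discreteSeries k x (renormBasis k n)).1 =
      s • principalSeries (Complex.I * (|k| : ℤ)) x (char n) := by
    show principalSeries (Complex.I * (|k| : ℤ)) x (s • char n) = _
    rw [map_smul]
  have h2 : (renormBasis k n).1 = s • char n := rfl
  have hlin : ∀ (f : C(Circle, ℂ)) (m : ℤ), kCoeff (s • f) m = s * kCoeff f m := fun f m => by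
    rw [← kCoeffCLM_apply, map_smul, kCoeffCLM_apply, smul_eq_mul]
  rw [discreteCoeff, renormInner, tsum_eq_single n]
  · rw [h1, h2, hlin, hlin, kCoeff_char, if_pos rfl, mul_one, hs, Complex.conj_ofReal]
    have : ((typeWeight k n : ℝ) : ℂ) * ((1 / √(typeWeight k n) : ℝ) : ℂ) *
        ((1 / √(typeWeight k n) : ℝ) : ℂ) = 1 := by
      norm_cast
      have h3 := Real.sq_sqrt hw.le
      have h4 := (Real.sqrt_pos.2 hw).ne'
      field_simp
      exact h3.symm
    linear_combination
      (kCoeff (principalSeries (Complex.I * (|k| : ℤ)) x (char n)) n) * this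
  · intro m hm
    rw [h2, hlin, kCoeff_char, if_neg (fun h => hm (Subtype.ext h.symm))]
    simp

/-- Complex conjugation commutes with `π_{iK}`, because `i·iK - 1` is real, and exchanges `e_m` with
`e_{-m}`. This reduces `k < 0` to `k > 0`. -/
lemma exists_discreteCoeff_eq (k : ℤ) (n : kTypes k) : ∃ j : ℕ,
    (∀ x, discreteCoeff k n x = kCoeff (principalSeries (Complex.I * k.natAbs) x
      (char (k.natAbs + 1 + 2 * j))) (k.natAbs + 1 + 2 * j)) ∨
    (∀ x, discreteCoeff k n x = (starRingEnd ℂ) (kCoeff (principalSeries (Complex.I * k.natAbs) x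
      (char (k.natAbs + 1 + 2 * j))) (k.natAbs + 1 + 2 * j))) := by
  have hK : (Complex.I * (|k| : ℤ) : ℂ) = Complex.I * (k.natAbs : ℂ) := by
    rw [Int.abs_eq_natAbs, Int.cast_natCast]
  obtain ⟨n, hn⟩ := n
  have hm := hn
  unfold kTypes at hm
  split_ifs at hm with h1
  · obtain ⟨⟨s, hs⟩, hm2⟩ := hm
    refine ⟨s.toNat, Or.inl fun x => ?_⟩
    have : n = k.natAbs + 1 + 2 * s.toNat := by omega
    rw [discreteCoeff_eq, hK]
    simp only [← this]
  · obtain ⟨⟨s, hs⟩, hm2⟩ := hm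
    refine ⟨(-s - 1).toNat, Or.inr fun x => ?_⟩
    have : n = -(k.natAbs + 1 + 2 * (-s - 1).toNat) := by omega
    rw [discreteCoeff_eq, hK, ← kCoeff_star, star_principalSeries, star_char]
    simp only [← this]

lemma continuous_coordA : Continuous coordA := by
  have : coordA = fun x : SL2R => (((x 0 0 + x 1 1) / 2 : ℝ) : ℂ) +
      ((x 1 0 - x 0 1) / 2 : ℝ) * Complex.I := by
    ext x
    exact Complex.mk_eq_add_mul_I _ _
  rw [this]
  fun_prop

lemma continuous_coordC : Continuous coordC := by
  have : coordC = fun x : SL2R => (((x 0 0 - x 1 1) / 2 : ℝ) : ℂ) +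
      (-(x 1 0 + x 0 1) / 2 : ℝ) * Complex.I := by
    ext x
    exact Complex.mk_eq_add_mul_I _ _
  rw [this]
  fun_prop

lemma continuous_kCoeff_principalSeries (K j : ℕ) : Continuous fun x : SL2R =>
    kCoeff (principalSeries (Complex.I * K) x (char (K + 1 + 2 * j))) (K + 1 + 2 * j) := by
  simp only [kCoeff_principalSeries]
  have h1 := continuous_coordA
  have h2 := continuous_coordC
  have h3 := continuous_jacobiPolySum (j + K) j
  refine ((Complex.continuous_conj.comp h1).pow _ |>.mul
    ((h1.pow _).inv₀ fun x => pow_ne_zero _ (coordA_ne_zero x))).mul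
    (Complex.continuous_ofReal.comp (h3.comp ?_))
  exact (Complex.continuous_normSq.comp h2).div (Complex.continuous_normSq.comp h1)
    fun x => (Complex.normSq_pos.2 (coordA_ne_zero x)).ne'

lemma continuous_discreteCoeff (k : ℤ) (n : kTypes k) :
    Continuous (discreteCoeff k n) := by
  obtain ⟨j, h | h⟩ := exists_discreteCoeff_eq k n
  · rw [funext h]
    exact continuous_kCoeff_principalSeries _ _
  · rw [funext h]
    exact Complex.continuous_conj.comp (continuous_kCoeff_principalSeries _ _)

/-- Two-sided estimates for the diagonal matrix coefficients of the discrete series. -/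
lemma discreteCoeff_estimates (k : ℤ) (n : kTypes k) : ∃ c C T : ℝ, 0 < c ∧ 0 < C ∧
    (∀ x, ‖discreteCoeff k n x‖ ≤
      C * Complex.normSq (coordA x) ^ (-((|(k : ℝ)| + 1) / 2))) ∧
    (∀ x, T ≤ Complex.normSq (coordA x) →
      c * Complex.normSq (coordA x) ^ (-((|(k : ℝ)| + 1) / 2)) ≤ ‖discreteCoeff k n x‖) := by
  obtain ⟨j, hj⟩ := exists_discreteCoeff_eq k n
  set K := k.natAbs with hK
  have hKk : |(k : ℝ)| = K := by rw [hK, Nat.cast_natAbs, Int.cast_abs]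
  have hnorm : ∀ x, ‖discreteCoeff k n x‖ =
      |jacobiPolySum (j + K) j (Complex.normSq (coordC x) / Complex.normSq (coordA x))| *
        Complex.normSq (coordA x) ^ (-((|(k : ℝ)| + 1) / 2)) := by
    intro x
    have h0 : ‖discreteCoeff k n x‖ = ‖kCoeff (principalSeries (Complex.I * K) x
        (char (K + 1 + 2 * j))) (K + 1 + 2 * j)‖ := by
      rcases hj with h | h
      · rw [h]
      · rw [h, RCLike.norm_conj]
    rw [h0, norm_kCoeff_principalSeries, mul_comm]
    congr 1
    rw [Complex.normSq_eq_norm_sq, hKk, ← Real.rpow_natCast _ 2, ← Real.rpow_mul (norm_nonneg _),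
      ← Real.rpow_natCast, ← Real.rpow_neg (norm_nonneg _)]
    congr 1
    push_cast
    ring
  have hpow : ∀ x, 0 ≤ Complex.normSq (coordA x) ^ (-((|(k : ℝ)| + 1) / 2)) := fun x =>
    Real.rpow_nonneg (Complex.normSq_nonneg _) _
  have hcont := (continuous_jacobiPolySum (j + K) j).abs
  have hone : 0 < |jacobiPolySum (j + K) j 1| := abs_pos.2 (jacobiPolySum_one_ne_zero K j)
  obtain ⟨C, hC⟩ := (isCompact_Icc (a := (0 : ℝ)) (b := 1)).exists_bound_of_continuousOn
    hcont.continuousOn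
  have hlow : ∀ᶠ s in nhds (1 : ℝ), |jacobiPolySum (j + K) j 1| / 2 < |jacobiPolySum (j + K) j s| :=
    hcont.continuousAt.eventually_const_lt (half_lt_self hone)
  obtain ⟨ε, hε, hball⟩ := Metric.eventually_nhds_iff.1 hlow
  -- The argument of the polynomial lies in `[0, 1]` at distance `1/|A|²` from `1`, so `|A|² ≥ 2/ε`
  -- puts it inside the `ε`-ball where the polynomial exceeds half its value at `1`. The maximum
  -- with `1` only ensures positivity.
  refine ⟨|jacobiPolySum (j + K) j 1| / 2, max C 1, 2 / ε, by positivity, by positivity, ?_, ?_⟩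
  · intro x
    rw [hnorm]
    refine mul_le_mul_of_nonneg_right (le_trans ?_ (le_max_left _ _)) (hpow x)
    have h := normSq_coord x
    have h2 := Complex.normSq_nonneg (coordC x)
    have h3 := hC (Complex.normSq (coordC x) / Complex.normSq (coordA x))
      ⟨div_nonneg h2 (Complex.normSq_nonneg _), div_le_one_of_le₀ (by linarith) (by linarith)⟩
    simpa using h3
  · intro x hx
    rw [hnorm]
    refine mul_le_mul_of_nonneg_right (le_of_lt (hball ?_)) (hpow x)
    have h := normSq_coord x
    have h2 := Complex.normSq_pos.2 (coordA_ne_zero x)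
    have h3 : Complex.normSq (coordC x) / Complex.normSq (coordA x) - 1 =
        -(1 / Complex.normSq (coordA x)) := by
      field_simp
      linarith
    rw [Real.dist_eq, h3, abs_neg, abs_of_pos (by positivity), div_lt_iff₀ h2]
    rw [div_le_iff₀ hε] at hx
    linarith

end SL2R

/-! ### Lorentz norms of functions with power-law distribution -/

lemma lintegral_Ioc_one_div_eq_top {a : ℝ} (ha : 0 < a) :
    ∫⁻ t in Set.Ioc (0 : ℝ) a, ENNReal.ofReal (1 / t) = ∞ := by
  by_contra h
  have h1 : IntegrableOn (fun t : ℝ => t⁻¹) (Set.Ioc 0 a) := by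
    refine ⟨by fun_prop, ?_⟩
    rw [hasFiniteIntegral_iff_ofReal]
    · simpa only [one_div] using lt_top_iff_ne_top.2 h
    · filter_upwards [ae_restrict_mem measurableSet_Ioc] with t ht
      exact inv_nonneg.2 ht.1.le
  have h2 := (intervalIntegrable_iff_integrableOn_Ioc_of_le ha.le).2 h1
  rw [intervalIntegrable_inv_iff] at h2
  rcases h2 with h2 | h2
  · exact ha.ne h2
  · exact h2 (by simp [ha.le])

section Lorentz

variable {X : Type*} [MeasurableSpace X] {μ : Measure X} {f : X → ℂ}

lemma lorentzNorm_top (p : ℝ) : lorentzNorm μ f p ∞ =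
    ⨆ (α : ℝ) (_ : 0 < α), ENNReal.ofReal (α ^ p) * distribFun μ f α := if_pos rfl

/-- A bounded function whose distribution function is `O(α^{-s})` is in weak `L^p` for `s ≤ p`. -/
lemma lorentzNorm_top_lt_top {s p C D : ℝ} (hsp : s ≤ p)
    (hbdd : ∀ x, ‖f x‖ ≤ C)
    (hup : ∀ α, 0 < α → distribFun μ f α ≤ ENNReal.ofReal (D * α ^ (-s))) :
    lorentzNorm μ f p ∞ < ∞ := by
  rw [lorentzNorm_top]
  refine lt_of_le_of_lt (iSup₂_le fun α hα => ?_) (ENNReal.ofReal_lt_top (r := |D| * C ^ (p - s)))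
  -- Large `α` contribute nothing because `f` is bounded by `C`; for `α < C` the exponent `p - s` is
  -- nonnegative.
  rcases lt_or_ge α C with h | h
  · refine (mul_le_mul_right (hup α hα) _).trans ?_
    rw [← ENNReal.ofReal_mul (Real.rpow_nonneg hα.le _)]
    refine ENNReal.ofReal_le_ofReal ?_
    have e : α ^ p * (D * α ^ (-s)) = D * α ^ (p - s) := by
      rw [sub_eq_add_neg, Real.rpow_add hα]; ring
    rw [e]
    have h1 : α ^ (p - s) ≤ C ^ (p - s) := Real.rpow_le_rpow hα.le h.le (by linarith)
    have h2 : 0 ≤ α ^ (p - s) := Real.rpow_nonneg hα.le _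
    calc D * α ^ (p - s) ≤ |D| * α ^ (p - s) := by gcongr; exact le_abs_self D
      _ ≤ _ := by gcongr
  · have : {x | α < ‖f x‖} = ∅ := by
      ext x
      simpa using (hbdd x).trans h
    rw [distribFun, this]
    simp

/-- The quantity `α^p d_f(α)` is at least `D α^{p-s}`, which blows up as `α → 0`. -/
lemma lorentzNorm_top_eq_top {s p D a : ℝ} (ha : 0 < a) (hD : 0 < D) (hsp : p < s)
    (hlow : ∀ α, 0 < α → α ≤ a → ENNReal.ofReal (D * α ^ (-s)) ≤ distribFun μ f α) :
    lorentzNorm μ f p ∞ = ∞ := by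
  rw [lorentzNorm_top]
  have ht : Filter.Tendsto (fun α : ℝ => ENNReal.ofReal (D * α ^ (p - s)))
      (nhdsWithin 0 (Set.Ioi 0)) (nhds ∞) :=
    ENNReal.tendsto_ofReal_nhds_top.2
      ((tendsto_rpow_neg_nhdsGT_zero (by linarith)).const_mul_atTop hD)
  refine top_le_iff.1 (le_of_tendsto ht ?_)
  filter_upwards [Ioc_mem_nhdsGT ha] with α hα
  refine le_trans ?_ (le_iSup₂ (f := fun (α : ℝ) (_ : 0 < α) =>
    ENNReal.ofReal (α ^ p) * distribFun μ f α) α hα.1)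
  refine le_trans ?_ (mul_le_mul_right (hlow α hα.1 hα.2) _)
  rw [← ENNReal.ofReal_mul (Real.rpow_nonneg hα.1.le _), sub_eq_add_neg, Real.rpow_add hα.1]
  exact ENNReal.ofReal_le_ofReal (le_of_eq (by ring))

/-- At the critical exponent the powers of `α` in `α^q d_f(α)^{q/p}` cancel, whatever `q` is, so the
integrand dominates a constant times `1/α` near `0`. -/
lemma lorentzNorm_eq_top {p D a : ℝ} {q : ℝ≥0∞} (hp : 0 < p) (hq : 0 < q) (hq' : q ≠ ∞)
    (ha : 0 < a) (hD : 0 < D)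
    (hlow : ∀ α, 0 < α → α ≤ a → ENNReal.ofReal (D * α ^ (-p)) ≤ distribFun μ f α) :
    lorentzNorm μ f p q = ∞ := by
  have hr : 0 < q.toReal := ENNReal.toReal_pos hq.ne' hq'
  rw [lorentzNorm, if_neg hq']
  set r := q.toReal with hrdef
  suffices h : ∫⁻ α in Set.Ioi (0 : ℝ),
      ENNReal.ofReal (α ^ r) * distribFun μ f α ^ (r / p) * ENNReal.ofReal (1 / α) = ∞ by
    rw [h, ENNReal.top_rpow_of_pos (by positivity), ENNReal.mul_top]
    exact (ENNReal.ofReal_pos.2 (by positivity)).ne'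
  refine top_le_iff.1 ?_
  calc (∞ : ℝ≥0∞) = ENNReal.ofReal (D ^ (r / p)) *
        ∫⁻ t in Set.Ioc (0 : ℝ) a, ENNReal.ofReal (1 / t) := by
        rw [lintegral_Ioc_one_div_eq_top ha, ENNReal.mul_top]
        exact (ENNReal.ofReal_pos.2 (by positivity)).ne'
    _ = ∫⁻ t in Set.Ioc (0 : ℝ) a, ENNReal.ofReal (D ^ (r / p)) * ENNReal.ofReal (1 / t) :=
        (lintegral_const_mul' _ _ ENNReal.ofReal_ne_top).symm
    _ ≤ ∫⁻ α in Set.Ioc (0 : ℝ) a,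
        ENNReal.ofReal (α ^ r) * distribFun μ f α ^ (r / p) * ENNReal.ofReal (1 / α) := by
        refine setLIntegral_mono' measurableSet_Ioc fun α hα => ?_
        refine mul_le_mul_left ?_ _
        refine le_trans ?_ (mul_le_mul_right
          (ENNReal.rpow_le_rpow (hlow α hα.1 hα.2) (by positivity : 0 ≤ r / p)) _)
        have h1 : 0 < α ^ (-p) := Real.rpow_pos_of_pos hα.1 _
        rw [ENNReal.ofReal_rpow_of_pos (by positivity),
          ← ENNReal.ofReal_mul (Real.rpow_nonneg hα.1.le _)]
        refine ENNReal.ofReal_le_ofReal (le_of_eq ?_)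
        rw [Real.mul_rpow hD.le h1.le, ← Real.rpow_mul hα.1.le, mul_left_comm,
          ← Real.rpow_add hα.1]
        have : r + -p * (r / p) = 0 := by field_simp; ring
        rw [this, Real.rpow_zero, mul_one]
    _ ≤ _ := lintegral_mono_set Set.Ioc_subset_Ioi_self

lemma distribFun_le_of_growth {u : X → ℝ} (hu : ∀ x, 0 < u x) {β C c₂ : ℝ} (hβ : 0 < β)
    (hC : 0 < C) (hf : ∀ x, ‖f x‖ ≤ C * u x ^ (-β))
    (hgrowth : ∀ T, 0 < T → μ {x | u x ≤ T} ≤ ENNReal.ofReal (c₂ * T)) {α : ℝ} (hα : 0 < α) :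
    distribFun μ f α ≤ ENNReal.ofReal (c₂ * C ^ (1 / β) * α ^ (-(1 / β))) := by
  have hsub : {x | α < ‖f x‖} ⊆ {x | u x ≤ (C / α) ^ (1 / β)} := by
    intro x hx
    have h1 : α < C * u x ^ (-β) := lt_of_lt_of_le hx (hf x)
    rw [Real.rpow_neg (hu x).le, ← div_eq_mul_inv,
      lt_div_iff₀ (Real.rpow_pos_of_pos (hu x) _)] at h1
    have h2 : u x ^ β ≤ C / α := by
      rw [le_div_iff₀ hα]; linarith
    show u x ≤ _
    calc u x = (u x ^ β) ^ (1 / β) := by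
          rw [← Real.rpow_mul (hu x).le, mul_one_div_cancel hβ.ne', Real.rpow_one]
      _ ≤ _ := Real.rpow_le_rpow (Real.rpow_nonneg (hu x).le _) h2 (by positivity)
  refine (measure_mono hsub).trans ((hgrowth _ (by positivity)).trans (le_of_eq ?_))
  rw [Real.div_rpow hC.le hα.le, Real.rpow_neg hα.le]
  ring_nf

/-- The lower bound on `f` holds only where `u` is large, hence the growth hypothesis on shells `T/4
≤ u ≤ T` instead of sublevel sets. -/
lemma le_distribFun_of_growth {u : X → ℝ} (hu : ∀ x, 0 < u x) {β c c₁ T₀ T₁ : ℝ} (hβ : 0 < β)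
    (hc : 0 < c) (hf : ∀ x, T₁ ≤ u x → c * u x ^ (-β) ≤ ‖f x‖)
    (hgrowth : ∀ T, T₀ ≤ T → ENNReal.ofReal (c₁ * T) ≤ μ {x | T / 4 ≤ u x ∧ u x ≤ T}) :
    ∃ a, 0 < a ∧ ∀ α, 0 < α → α ≤ a →
      ENNReal.ofReal (c₁ * (c / 2) ^ (1 / β) * α ^ (-(1 / β))) ≤ distribFun μ f α := by
  -- `T` is chosen below so that `c T^{-β} = 2α`, the factor `2` giving a strict inequality. The
  -- bound `α ≤ c/2 * M^{-β}` says `T ≥ M`, so the shell lies in `u ≥ T₁`.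
  set M := max (max T₀ (4 * T₁)) 1 with hM
  have hM0 : 0 < M := lt_of_lt_of_le one_pos (le_max_right _ _)
  refine ⟨c / 2 * M ^ (-β), by positivity, fun α hα ha => ?_⟩
  set T := (c / 2 / α) ^ (1 / β) with hT
  have hTpos : 0 < T := by positivity
  have hTβ : T ^ β = c / 2 / α := by
    rw [hT, ← Real.rpow_mul (by positivity), one_div_mul_cancel hβ.ne', Real.rpow_one]
  have hMT : M ≤ T := by
    refine (Real.rpow_le_rpow_iff hM0.le hTpos.le hβ).1 ?_
    rw [hTβ, le_div_iff₀ hα]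
    rw [Real.rpow_neg hM0.le, ← div_eq_mul_inv, le_div_iff₀ (by positivity)] at ha
    linarith
  have h1 : T₀ ≤ T := (le_max_left _ _).trans ((le_max_left _ _).trans hMT)
  have h2 : 4 * T₁ ≤ T := (le_max_right _ _).trans ((le_max_left _ _).trans hMT)
  refine le_trans (le_of_eq ?_) ((hgrowth T h1).trans (measure_mono ?_))
  · rw [hT, Real.div_rpow (by positivity) hα.le, Real.rpow_neg hα.le]
    ring_nf
  · rintro x ⟨hx1, hx2⟩
    refine lt_of_lt_of_le ?_ (hf x (by linarith))
    have h3 : T ^ (-β) ≤ u x ^ (-β) :=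
      Real.rpow_le_rpow_of_nonpos (hu x) hx2 (by linarith)
    refine lt_of_lt_of_le ?_ (mul_le_mul_of_nonneg_left h3 hc.le)
    rw [Real.rpow_neg hTpos.le, hTβ]
    field_simp
    linarith

/-- Membership in the Lorentz spaces for functions that behave like `u^{-β}`, where the measure of
`{u ≤ T}` grows linearly. -/
lemma memLorentz_iff_of_growth {u : X → ℝ} (hmeas : AEStronglyMeasurable f μ) (hu : ∀ x, 1 ≤ u x)
    {β c C c₁ c₂ T₀ T₁ : ℝ} (hβ : 0 < β) (hc : 0 < c) (hC : 0 < C) (hc₁ : 0 < c₁)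
    (hf : ∀ x, ‖f x‖ ≤ C * u x ^ (-β)) (hf' : ∀ x, T₁ ≤ u x → c * u x ^ (-β) ≤ ‖f x‖)
    (hgrowth : ∀ T, 0 < T → μ {x | u x ≤ T} ≤ ENNReal.ofReal (c₂ * T))
    (hgrowth' : ∀ T, T₀ ≤ T → ENNReal.ofReal (c₁ * T) ≤ μ {x | T / 4 ≤ u x ∧ u x ≤ T})
    {p : ℝ} (hp : 0 < p) :
    (1 / β ≤ p ↔ MemLorentz μ f p ∞) ∧
    (1 / β = p → ∀ q : ℝ≥0∞, 0 < q → (MemLorentz μ f p q ↔ q = ∞)) := by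
  have hu0 : ∀ x, 0 < u x := fun x => one_pos.trans_le (hu x)
  have hbdd : ∀ x, ‖f x‖ ≤ C := fun x => (hf x).trans
    (mul_le_of_le_one_right hC.le (Real.rpow_le_one_of_one_le_of_nonpos (hu x) (by linarith)))
  obtain ⟨a, ha, hlow⟩ := le_distribFun_of_growth hu0 hβ hc hf' hgrowth'
  have hD : 0 < c₁ * (c / 2) ^ (1 / β) := by positivity
  have hmem : 1 / β ≤ p → MemLorentz μ f p ∞ := fun h =>
    ⟨hmeas, lorentzNorm_top_lt_top h hbdd
      fun α hα => distribFun_le_of_growth hu0 hβ hC hf hgrowth hα⟩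
  refine ⟨⟨hmem, fun h => ?_⟩, fun h q hq => ⟨fun hm => ?_, fun hq' => ?_⟩⟩
  · by_contra! hlt
    exact h.2.ne (lorentzNorm_top_eq_top ha hD hlt hlow)
  · by_contra hq'
    subst h
    exact hm.2.ne (lorentzNorm_eq_top hp hq hq' ha hD hlow)
  · rw [hq']
    exact hmem h.le

end Lorentz

namespace SL2R

/-! ### Haar measure as a cone measure -/

instance instLocallyCompactSpaceSL2R : LocallyCompactSpace SL2R := by
  have : LocallyCompactSpace (Matrix (Fin 2) (Fin 2) ℝ) :=
    inferInstanceAs (LocallyCompactSpace (Fin 2 → Fin 2 → ℝ))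
  exact Matrix.SpecialLinearGroup.isClosedEmbedding_val.locallyCompactSpace

instance instSecondCountableTopologySL2R : SecondCountableTopology SL2R := by
  have : SecondCountableTopology (Matrix (Fin 2) (Fin 2) ℝ) :=
    inferInstanceAs (SecondCountableTopology (Fin 2 → Fin 2 → ℝ))
  exact Matrix.SpecialLinearGroup.isClosedEmbedding_val.isEmbedding.secondCountableTopology

/-- The determinant of the matrix with coordinates `(A, C)`. -/
def coneForm (v : ℂ × ℂ) : ℝ := Complex.normSq v.1 - Complex.normSq v.2

lemma continuous_coneForm : Continuous coneForm :=
  (Complex.continuous_normSq.comp continuous_fst).sub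
    (Complex.continuous_normSq.comp continuous_snd)

/-- The matrix of determinant one on the ray of the matrix with coordinates `v`. -/
def coneNormalize (v : ℂ × ℂ) (h : 0 < coneForm v) : SL2R :=
  ⟨!![(v.1.re + v.2.re) / √(coneForm v), (-v.1.im - v.2.im) / √(coneForm v);
    (v.1.im - v.2.im) / √(coneForm v), (v.1.re - v.2.re) / √(coneForm v)], by
    have h1 := Real.sq_sqrt h.le
    have h2 := (Real.sqrt_pos.2 h).ne'
    rw [Matrix.det_fin_two_of]
    field_simp
    rw [h1, coneForm, Complex.normSq_apply, Complex.normSq_apply]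
    ring⟩

open Classical in
/-- The radial projection of the open cone of matrices of positive determinant to `SL(2, ℝ)`. -/
def coneProj (v : ℂ × ℂ) : SL2R :=
  if h : 0 < coneForm v then coneNormalize v h else 1

lemma coneProj_apply {v : ℂ × ℂ} (h : 0 < coneForm v) :
    (coneProj v : Matrix (Fin 2) (Fin 2) ℝ) =
      !![(v.1.re + v.2.re) / √(coneForm v), (-v.1.im - v.2.im) / √(coneForm v);
      (v.1.im - v.2.im) / √(coneForm v), (v.1.re - v.2.re) / √(coneForm v)] := by
  rw [coneProj, dif_pos h]
  rfl

lemma measurable_coneProj : Measurable coneProj := by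
  classical
  have hs : IsOpen {v | 0 < coneForm v} := isOpen_lt continuous_const continuous_coneForm
  have h1 : ContinuousOn coneProj {v | 0 < coneForm v} := by
    have hind : Topology.IsInducing fun x : SL2R => (x : Matrix (Fin 2) (Fin 2) ℝ) :=
      Matrix.SpecialLinearGroup.isClosedEmbedding_val.isInducing
    rw [hind.continuousOn_iff]
    have hc : ContinuousOn (fun v : ℂ × ℂ => !![(v.1.re + v.2.re) / √(coneForm v),
        (-v.1.im - v.2.im) / √(coneForm v);
        (v.1.im - v.2.im) / √(coneForm v), (v.1.re - v.2.re) / √(coneForm v)])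
        {v | 0 < coneForm v} := by
      have hq : ContinuousOn (fun v => √(coneForm v)) {v | 0 < coneForm v} :=
        continuous_coneForm.sqrt.continuousOn
      have hq0 : ∀ v ∈ {v | 0 < coneForm v}, √(coneForm v) ≠ 0 :=
        fun v hv => (Real.sqrt_pos.2 hv).ne'
      refine continuousOn_pi.2 fun i => continuousOn_pi.2 fun j => ?_
      fin_cases i <;> fin_cases j <;>
        exact ContinuousOn.div (Continuous.continuousOn (by fun_prop)) hq hq0
    exact hc.congr fun v hv => coneProj_apply hv
  have h2 : ContinuousOn (fun _ : ℂ × ℂ => (1 : SL2R)) {v | 0 < coneForm v}ᶜ :=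
    continuousOn_const
  have h3 := h1.measurable_piecewise h2 hs.measurableSet
  convert h3 using 1
  ext1 v
  by_cases hv : 0 < coneForm v
  · exact (Set.piecewise_eq_of_mem {v | 0 < coneForm v} _ _ hv).symm
  · have h4 : coneProj v = 1 := by rw [coneProj, dif_neg hv]
    exact h4.trans (Set.piecewise_eq_of_notMem {v | 0 < coneForm v} coneProj (fun _ => 1) hv).symm

lemma normSq_coordA_coneProj {v : ℂ × ℂ} (h : 0 < coneForm v) :
    Complex.normSq (coordA (coneProj v)) = Complex.normSq v.1 / coneForm v := by
  have h1 := Real.sq_sqrt h.le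
  have h2 := (Real.sqrt_pos.2 h).ne'
  rw [coordA, coneProj_apply h, Complex.normSq_mk, Complex.normSq_apply]
  rw [eq_div_iff h.ne']
  conv_lhs => rw [← h1]
  simp
  field_simp
  ring

/-- Left multiplication by `x` in the coordinates `(A, C)`. -/
def coneAction (x : SL2R) : (ℂ × ℂ) →ₗ[ℂ] (ℂ × ℂ) where
  toFun v := (coordA x * v.1 + (starRingEnd ℂ) (coordC x) * v.2,
    coordC x * v.1 + (starRingEnd ℂ) (coordA x) * v.2)
  map_add' v w := by ext <;> simp <;> ring
  map_smul' c v := by ext <;> simp <;> ring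

lemma coneAction_apply (x : SL2R) (v : ℂ × ℂ) :
    coneAction x v = (coordA x * v.1 + (starRingEnd ℂ) (coordC x) * v.2,
    coordC x * v.1 + (starRingEnd ℂ) (coordA x) * v.2) := rfl

/-- Taking the conjugate of `B` as second coordinate makes left multiplication complex linear, with
a matrix in `SU(1,1)`; its determinant is `|A|² - |C|²`. -/
lemma det_coneAction (x : SL2R) : LinearMap.det (coneAction x) = 1 := by
  rw [← LinearMap.det_toMatrix (Module.Basis.finTwoProd ℂ), Matrix.det_fin_two]
  simp only [LinearMap.toMatrix_apply, Module.Basis.finTwoProd_zero, Module.Basis.finTwoProd_one,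
    coneAction_apply, Module.Basis.coe_finTwoProd_repr]
  have h := congrArg (Complex.ofReal) (normSq_coord x)
  push_cast at h
  rw [← Complex.mul_conj, ← Complex.mul_conj] at h
  simp
  linear_combination h

lemma coneForm_coneAction (x : SL2R) (v : ℂ × ℂ) : coneForm (coneAction x v) = coneForm v := by
  have h : coneForm (coneAction x v) =
      (Complex.normSq (coordA x) - Complex.normSq (coordC x)) * coneForm v := by
    simp only [coneForm, coneAction_apply, Complex.normSq_apply, Complex.add_re, Complex.add_im,
      Complex.mul_re, Complex.mul_im, Complex.conj_re, Complex.conj_im]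
    ring
  rw [h, normSq_coord, one_mul]

lemma coneProj_coneAction (x : SL2R) {v : ℂ × ℂ} (hv : 0 < coneForm v) :
    coneProj (coneAction x v) = x * coneProj v := by
  have hv' : 0 < coneForm (coneAction x v) := by rwa [coneForm_coneAction]
  apply Subtype.ext
  rw [coneProj_apply hv', Matrix.SpecialLinearGroup.coe_mul, coneProj_apply hv,
    coneForm_coneAction, coneAction_apply]
  ext i j
  fin_cases i <;> fin_cases j <;>
    simp [Matrix.mul_apply, Fin.sum_univ_two, coordA, coordC] <;> ring

/-- The part of the cone where the determinant is at most one. -/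
def coneUnit : Set (ℂ × ℂ) := {v | 0 < coneForm v ∧ coneForm v ≤ 1}

/-- The cone measure on `SL(2, ℝ)`. -/
def coneMeasure : Measure SL2R := (volume.restrict coneUnit).map coneProj

lemma coneMeasure_apply {s : Set SL2R} (hs : MeasurableSet s) :
    coneMeasure s = volume (coneProj ⁻¹' s ∩ coneUnit) := by
  rw [coneMeasure, Measure.map_apply measurable_coneProj hs,
    Measure.restrict_apply (measurable_coneProj hs)]

/-- Left multiplication preserves Lebesgue measure and the determinant form, hence `coneUnit`, and
commutes with the radial projection. -/
instance : coneMeasure.IsMulLeftInvariant where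
  map_mul_left_eq_self x := by
    ext s hs
    have hx : Measurable fun y : SL2R => x * y := (continuous_const_mul x).measurable
    rw [Measure.map_apply hx hs, coneMeasure_apply (hx hs), coneMeasure_apply hs]
    -- The real determinant is the norm from `ℂ` to `ℝ` of the complex one.
    have hdet : LinearMap.det ((coneAction x).restrictScalars ℝ) = 1 := by
      have h := LinearMap.det_restrictScalars (R := ℝ) (f := coneAction x)
      rw [det_coneAction, map_one] at h
      exact h
    have : (volume : Measure (ℂ × ℂ)).IsAddHaarMeasure := by
      rw [Measure.volume_eq_prod]
      infer_instance
    have h := Measure.addHaar_preimage_linearMap (volume : Measure (ℂ × ℂ))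
      (f := (coneAction x).restrictScalars ℝ) (by rw [hdet]; exact one_ne_zero)
      (coneProj ⁻¹' s ∩ coneUnit)
    rw [hdet, inv_one, abs_one, ENNReal.ofReal_one, one_mul] at h
    rw [← h]
    congr 1
    ext v
    simp only [Set.mem_inter_iff, Set.mem_preimage, LinearMap.coe_restrictScalars, coneUnit,
      Set.mem_ofPred_eq, coneForm_coneAction]
    refine and_congr_left fun hv => ?_
    rw [coneProj_coneAction x hv.1]

/-! ### Volume growth -/

lemma volume_annulus {a b : ℝ} (ha : 0 ≤ a) (hab : a ≤ b) :
    volume {z : ℂ | a ≤ Complex.normSq z ∧ Complex.normSq z ≤ b} =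
      ENNReal.ofReal (Real.pi * (b - a)) := by
  have h : {z : ℂ | a ≤ Complex.normSq z ∧ Complex.normSq z ≤ b} =
      Metric.closedBall 0 √b \ Metric.ball 0 √a := by
    ext z
    simp only [Set.mem_ofPred_eq, Set.mem_sdiff, mem_closedBall_zero_iff, mem_ball_zero_iff, not_lt,
      Complex.normSq_eq_norm_sq]
    rw [Real.sqrt_le_left (norm_nonneg z), Real.le_sqrt (norm_nonneg z) (ha.trans hab), and_comm]
  have hsub : Metric.ball (0 : ℂ) √a ⊆ Metric.closedBall 0 √b :=
    (Metric.ball_subset_ball (Real.sqrt_le_sqrt hab)).trans Metric.ball_subset_closedBall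
  rw [h, measure_sdiff hsub measurableSet_ball.nullMeasurableSet measure_ball_lt_top.ne,
    Complex.volume_closedBall, Complex.volume_ball, ← ENNReal.ofReal_pow (Real.sqrt_nonneg _),
    ← ENNReal.ofReal_pow (Real.sqrt_nonneg _), Real.sq_sqrt ha, Real.sq_sqrt (ha.trans hab)]
  have hpi : (NNReal.pi : ℝ≥0∞) = ENNReal.ofReal Real.pi := by
    rw [← NNReal.coe_real_pi, ENNReal.ofReal_coe_nnreal]
  rw [hpi, ← ENNReal.ofReal_mul ha, ← ENNReal.ofReal_mul (ha.trans hab),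
    ← ENNReal.ofReal_sub _ (mul_nonneg ha Real.pi_pos.le)]
  ring_nf

/-- The volume of a region in `ℂ × ℂ` over an annulus whose fibres are annuli. -/
lemma volume_annular_region {a b c d : ℝ} (ha : 0 ≤ a) (hab : a ≤ b) (hc : 0 ≤ c) (hcd : c ≤ d) :
    volume {v : ℂ × ℂ | (a ≤ Complex.normSq v.2 ∧ Complex.normSq v.2 ≤ b) ∧
      Complex.normSq v.2 + c ≤ Complex.normSq v.1 ∧
      Complex.normSq v.1 ≤ Complex.normSq v.2 + d} =
      ENNReal.ofReal (Real.pi ^ 2 * (b - a) * (d - c)) := by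
  have hn1 : Continuous fun v : ℂ × ℂ => Complex.normSq v.1 :=
    Complex.continuous_normSq.comp continuous_fst
  have hn2 : Continuous fun v : ℂ × ℂ => Complex.normSq v.2 :=
    Complex.continuous_normSq.comp continuous_snd
  have hn : Continuous fun z : ℂ => Complex.normSq z := Complex.continuous_normSq
  have hm : MeasurableSet {z : ℂ | a ≤ Complex.normSq z ∧ Complex.normSq z ≤ b} :=
    (measurableSet_le measurable_const hn.measurable).inter
      (measurableSet_le hn.measurable measurable_const)
  rw [Measure.volume_eq_prod, Measure.prod_apply_symm]
  · have h : ∀ w : ℂ, volume ((fun z : ℂ => (z, w)) ⁻¹' {v : ℂ × ℂ |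
        (a ≤ Complex.normSq v.2 ∧ Complex.normSq v.2 ≤ b) ∧
        Complex.normSq v.2 + c ≤ Complex.normSq v.1 ∧
        Complex.normSq v.1 ≤ Complex.normSq v.2 + d}) =
        Set.indicator {z : ℂ | a ≤ Complex.normSq z ∧ Complex.normSq z ≤ b}
          (fun _ => ENNReal.ofReal (Real.pi * (d - c))) w := by
      intro w
      by_cases hw : a ≤ Complex.normSq w ∧ Complex.normSq w ≤ b
      · rw [Set.indicator_of_mem (by exact hw)]
        have h1 := volume_annulus (add_nonneg (Complex.normSq_nonneg w) hc)
          (add_le_add_right hcd (Complex.normSq w))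
        rw [add_sub_add_left_eq_sub] at h1
        rw [← h1]
        congr 1
        ext z
        simp [hw]
      · rw [Set.indicator_of_notMem (by exact hw)]
        convert measure_empty (μ := (volume : Measure ℂ))
        ext z
        simp [hw]
    simp only [h]
    rw [lintegral_indicator_const hm, volume_annulus ha hab, ← ENNReal.ofReal_mul]
    · ring_nf
    · exact mul_nonneg Real.pi_pos.le (by linarith)
  · refine MeasurableSet.inter ?_ ?_
    · exact (measurableSet_le measurable_const hn2.measurable).inter
        (measurableSet_le hn2.measurable measurable_const)
    · exact (measurableSet_le (hn2.add continuous_const).measurable hn1.measurable).inter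
        (measurableSet_le hn1.measurable (hn2.add continuous_const).measurable)

lemma continuous_normSq_coordA : Continuous fun x => Complex.normSq (coordA x) :=
  Complex.continuous_normSq.comp continuous_coordA

lemma coneMeasure_le {T : ℝ} (hT : 0 < T) :
    coneMeasure {x | Complex.normSq (coordA x) ≤ T} ≤ ENNReal.ofReal (Real.pi ^ 2 * T) := by
  rw [coneMeasure_apply
    (measurableSet_le continuous_normSq_coordA.measurable measurable_const)]
  have h := volume_annular_region le_rfl hT.le le_rfl zero_le_one
  rw [sub_zero, sub_zero, mul_one] at h
  rw [← h]
  refine measure_mono ?_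
  rintro v ⟨hv, hv0, hv1⟩
  have hv2 : Complex.normSq (coordA (coneProj v)) ≤ T := hv
  rw [normSq_coordA_coneProj hv0, div_le_iff₀ hv0] at hv2
  -- Over this set `|v.1|² ≤ T * coneForm v ≤ T`, and `|v.2|² < |v.1|²`; the cone part thus lies
  -- over a disc, with fibres inside annuli of area `π`.
  have h3 : T * coneForm v ≤ T := mul_le_of_le_one_right hT.le hv1
  unfold coneForm at hv0 hv1
  exact ⟨⟨Complex.normSq_nonneg _, by linarith⟩, by linarith, by linarith⟩

lemma le_coneMeasure {T : ℝ} (hT : 8 ≤ T) :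
    ENNReal.ofReal (Real.pi ^ 2 / 16 * T) ≤
      coneMeasure {x | T / 4 ≤ Complex.normSq (coordA x) ∧ Complex.normSq (coordA x) ≤ T} := by
  have hm : MeasurableSet
      {x | T / 4 ≤ Complex.normSq (coordA x) ∧ Complex.normSq (coordA x) ≤ T} :=
    (measurableSet_le measurable_const continuous_normSq_coordA.measurable).inter
      (measurableSet_le continuous_normSq_coordA.measurable measurable_const)
  rw [coneMeasure_apply hm]
  -- With form in `[1/2, 1]` and `T/4 ≤ |v.2|² ≤ T/2 - 1`, one has `T/4 ≤ |v.1|² ≤ T/2`, so the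
  -- ratio `|v.1|² / coneForm v` lies in `[T/4, T]`. The volume `π² (T/4 - 1)/2` is at least `π²
  -- T/16` exactly when `T ≥ 8`.
  have h := volume_annular_region (a := T / 4) (b := T / 2 - 1) (c := 1 / 2) (d := 1)
    (by linarith) (by linarith) (by norm_num) (by norm_num)
  refine le_trans (ENNReal.ofReal_le_ofReal ?_) (h.symm.le.trans (measure_mono ?_))
  · nlinarith [sq_nonneg Real.pi]
  · rintro v ⟨⟨h1, h2⟩, h3, h4⟩
    have hq1 : 1 / 2 ≤ coneForm v := by unfold coneForm; linarith
    have hq2 : coneForm v ≤ 1 := by unfold coneForm; linarith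
    have hq0 : 0 < coneForm v := by linarith
    refine ⟨?_, hq0, hq2⟩
    show T / 4 ≤ Complex.normSq (coordA (coneProj v)) ∧
      Complex.normSq (coordA (coneProj v)) ≤ T
    rw [normSq_coordA_coneProj hq0, div_le_iff₀ hq0, le_div_iff₀ hq0]
    constructor <;> nlinarith

instance : IsFiniteMeasureOnCompacts coneMeasure where
  lt_top_of_isCompact s hs := by
    obtain ⟨T, hT⟩ := hs.exists_bound_of_continuousOn continuous_normSq_coordA.continuousOn
    have hsub : s ⊆ {x | Complex.normSq (coordA x) ≤ max T 1} := fun x hx =>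
      (le_abs_self _).trans ((hT x hx).trans (le_max_left _ _))
    exact (measure_mono hsub).trans_lt
      ((coneMeasure_le (one_pos.trans_le (le_max_right T 1))).trans_lt ENNReal.ofReal_lt_top)

/-- Volume growth for a Haar measure of `SL(2, ℝ)`. -/
lemma haar_growth (μ : Measure SL2R) [μ.IsHaarMeasure] : ∃ c₁ c₂ : ℝ, 0 < c₁ ∧
    (∀ T, 0 < T → μ {x | Complex.normSq (coordA x) ≤ T} ≤ ENNReal.ofReal (c₂ * T)) ∧
    (∀ T, 8 ≤ T → ENNReal.ofReal (c₁ * T) ≤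
      μ {x | T / 4 ≤ Complex.normSq (coordA x) ∧ Complex.normSq (coordA x) ≤ T}) := by
  set b := coneMeasure.haarScalarFactor μ with hb
  have h : ∀ s, coneMeasure s = ENNReal.ofReal b * μ s := by
    intro s
    -- Uniqueness of Haar measure; the factor is nonzero because the cone measure has positive mass
    -- on the shell with `T = 8`.
    conv_lhs => rw [Measure.isMulLeftInvariant_eq_smul coneMeasure μ]
    rw [ENNReal.ofReal_coe_nnreal]
    rfl
  have hpi := Real.pi_pos
  have hb0 : 0 < (b : ℝ) := by
    rw [NNReal.coe_pos]
    refine pos_iff_ne_zero.2 fun h0 => ?_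
    have h1 := le_coneMeasure le_rfl
    rw [h, h0] at h1
    simp only [NNReal.coe_zero, ENNReal.ofReal_zero, zero_mul, nonpos_iff_eq_zero,
      ENNReal.ofReal_eq_zero] at h1
    have : 0 < Real.pi ^ 2 / 16 * 8 := by positivity
    linarith
  have hinv : ∀ s, μ s = ENNReal.ofReal (b : ℝ)⁻¹ * coneMeasure s := by
    intro s
    rw [h, ← mul_assoc, ← ENNReal.ofReal_mul (by positivity), inv_mul_cancel₀ hb0.ne',
      ENNReal.ofReal_one, one_mul]
  refine ⟨(b : ℝ)⁻¹ * (Real.pi ^ 2 / 16), (b : ℝ)⁻¹ * Real.pi ^ 2, by positivity, ?_, ?_⟩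
  · intro T hT
    rw [hinv, mul_assoc, ENNReal.ofReal_mul (by positivity)]
    exact mul_le_mul_right (coneMeasure_le hT) _
  · intro T hT
    rw [hinv, mul_assoc, ENNReal.ofReal_mul (by positivity)]
    exact mul_le_mul_right (le_coneMeasure hT) _

end SL2R

end

/-! ### Conclusion -/

theorem mainTheorem4 (μ : Measure SL2R) [μ.IsHaarMeasure] (p : ℝ) (hp0 : 0 < p) (hp2 : p ≤ 2)
    (k : ℤ) (hk : k ≠ 0) (n : SL2R.kTypes k) :
    (2 / p - 1 ≤ |(k : ℝ)| ↔ MemLorentz μ (SL2R.discreteCoeff k n) p ∞) ∧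
    (|(k : ℝ)| = 2 / p - 1 → ∀ q : ℝ≥0∞, 0 < q →
      (MemLorentz μ (SL2R.discreteCoeff k n) p q ↔ q = ∞)) := by
  obtain ⟨c, C, T, hc, hC, hup, hlow⟩ := SL2R.discreteCoeff_estimates k n
  obtain ⟨c₁, c₂, hc₁, hg, hg'⟩ := SL2R.haar_growth μ
  have hu : ∀ x : SL2R, 1 ≤ Complex.normSq x.coordA := fun x => by
    linarith [SL2R.normSq_coord x, Complex.normSq_nonneg x.coordC]
  have hβ : 0 < (|(k : ℝ)| + 1) / 2 := by positivity
  have h := memLorentz_iff_of_growth (SL2R.continuous_discreteCoeff k n).aestronglyMeasurable hu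
    hβ hc hC hc₁ hup hlow hg hg' hp0
  -- The critical exponent is `1/β = 2/(|k| + 1)`.
  have e1 : 2 / p - 1 ≤ |(k : ℝ)| ↔ 1 / ((|(k : ℝ)| + 1) / 2) ≤ p := by
    rw [div_le_iff₀ hβ, sub_le_iff_le_add, div_le_iff₀ hp0]
    constructor <;> intro h <;> linarith
  have e2 : |(k : ℝ)| = 2 / p - 1 ↔ 1 / ((|(k : ℝ)| + 1) / 2) = p := by
    rw [div_eq_iff hβ.ne', eq_sub_iff_add_eq, eq_div_iff hp0.ne']
    constructor <;> intro h <;> linarith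
  rw [e1, e2]
  exact h
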